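/- **Model.** There is a continuum of agents, each with one unit of an indivisible good, who may buy one unit, sell one unit or not trade. Valuations $\theta\in[0,1]$ have distribution $F$ with density $f$, continuous and positive on $(0,1)$. $F$ is regular: the virtual value $\mathcal V(\theta)=\theta-\frac{1-F(\theta)}{f(\theta)}$ and the virtual cost $\mathcal C(\theta)=\theta+\frac{F(\theta)}{f(\theta)}$ are (weakly) increasing on $(0,1)$. Let $p\in(0,1]$. A *direct mechanism* is a pair $q:[0,1]\to\{-1,0,1\}$, $t:[0,1]\to\mathbb R$ with $\theta q(\theta)-t(\theta)\ge\theta q(r)-t(r)$ for all $\theta,r\in[0,1]$; put $u(\theta)=\theta q(\theta)-t(\theta)$. The designer first announces, for each measurable set $S\subseteq[0,1]$ of types that may join, a direct mechanism $(q_S,t_S)$ with $\int_S q_S\,dF\le 0$ (shutting down is $q_S=t_S=0$). Each agent then joins the centralized marketplace, the decentralized search market, or neither. Let $S$ and $D$ be the sets of types joining the marketplace and the search market. *Payoffs.* In the search market, type $\theta$ meets with probability $p$ an agent drawn from $F$ conditional on $D$ and gets half of the surplus, so $u^d(\theta)=\frac p2\,\mathbb E\big[|x-\theta|\;\big|\;x\in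 D\big]$. In the marketplace she gets $u_S(\theta)=\theta q_S(\theta)-t_S(\theta)$. A market joined by a null set of agents gives $0$, as does joining neither market. The designer's profit is $\int_S t_S\,dF$. *Equilibrium.* After an announcement, $(S,D)$ is a subgame equilibrium if no agent gains by moving to another market or to neither, and there are no profitable bilateral deviations: there are no two agents of different types, both outside a given market, who both strictly gain by moving to that market together. If that market is otherwise null, the two meet only each other. In the search market they meet with probability $p$ and share the surplus equally, which gives each $\frac p2|\theta-\theta'|$. In the marketplace each gets $u_S$ if $q_S(\theta)+q_S(\theta')=0$ and $0$ otherwise. If that market is not null, each gets the payoff $u^d$, respectively $u_S$, of a single agent moving there. An announcement is admissible if its subgame has an equilibrium. An *equilibrium* is an admissible announcement and a response to each announcement such that the response to each admissible announcement is a subgame equilibrium, and no other admissible announcement gives the designer a higher profit given these responses. **Proposition (uniqueness of equilibrium).** 1. There is no equilibrium in which (almost) all agents join the centralized marketplace. 2. There is no equilibrium in which (almost) all agents join the decentralized search market. 3. The simple coexistence equilibrium is the unique equilibrium: - (a) there are an equilibrium and cutoffs $0<\underline\theta<\overline\theta<1$ with $F(\underline\theta)=1-F(\overline\theta)$ and $\mathcal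 C(\underline\theta)=\mathcal V(\overline\theta)$ such that exactly the types in $[0,\underline\theta]\cup[\overline\theta,1]$ join the marketplace and exactly those in $(\underline\theta,\overline\theta)$ join the search market; - (b) every equilibrium has, up to a null set of types, this form for some such pair of cutoffs; - (c) if moreover $\mathcal V$ or $\mathcal C$ is strictly increasing on $(0,1)$, then any two equilibria coincide up to null sets in who joins which market and in the quantities and transfers of those who join the marketplace. -/

import Mathlib

open MeasureTheory Set

noncomputable section

namespace MarketChoice

/-! ### Valuations -/

/-- `f` is a density on `[0,1]` that is continuous and positive in the interior; it may vanish or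
blow up at the two end points. (An integral equal to `1` makes `f` integrable.) -/
structure IsValuationDensity (f : ℝ → ℝ) : Prop where
  continuousOn : ContinuousOn f (Ioo 0 1)
  pos : ∀ θ ∈ Ioo (0 : ℝ) 1, 0 < f θ
  integral_eq_one : ∫ θ in Ioo (0 : ℝ) 1, f θ = 1

/-- The distribution of valuations with density `f`. -/
def law (f : ℝ → ℝ) : Measure ℝ :=
  (volume.restrict (Ioo 0 1)).withDensity fun θ => ENNReal.ofReal (f θ)

/-- The distribution function `F`. -/
def cdf (f : ℝ → ℝ) (θ : ℝ) : ℝ := (law f).real (Iic θ)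

/-- The virtual value `θ - (1 - F θ) / f θ`. -/
def virtualValue (f : ℝ → ℝ) (θ : ℝ) : ℝ := θ - (1 - cdf f θ) / f θ

/-- The virtual cost `θ + F θ / f θ`. -/
def virtualCost (f : ℝ → ℝ) (θ : ℝ) : ℝ := θ + cdf f θ / f θ

/-- Regular distributions: virtual value and virtual cost are (weakly) increasing. -/
structure IsRegular (f : ℝ → ℝ) : Prop where
  virtualValue_mono : MonotoneOn (virtualValue f) (Ioo 0 1)
  virtualCost_mono : MonotoneOn (virtualCost f) (Ioo 0 1)

/-! ### The centralized marketplace -/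

/-- A deterministic, incentive compatible direct mechanism: a report `θ` receives the net quantity
`q θ` (buy one unit, sell one unit, or no trade) and pays `t θ`. -/
structure DirectMechanism where
  q : ℝ → ℝ
  t : ℝ → ℝ
  deterministic : ∀ θ ∈ Icc (0 : ℝ) 1, q θ = -1 ∨ q θ = 0 ∨ q θ = 1
  incentiveCompatible : ∀ θ ∈ Icc (0 : ℝ) 1, ∀ r ∈ Icc (0 : ℝ) 1,
    θ * q r - t r ≤ θ * q θ - t θ

/-- Net utility of type `θ` from a truthful report. -/
def DirectMechanism.utility (m : DirectMechanism) (θ : ℝ) : ℝ := θ * m.q θ - m.t θ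

/-- What the designer announces: for each set `S` of types that may join, the direct mechanism that
she will operate. She cannot sell more units than she buys. Shutting down at `S` is the mechanism
with `q = 0` and `t = 0`. -/
structure Announcement (f : ℝ → ℝ) where
  terms : Set ℝ → DirectMechanism
  feasible : ∀ S ⊆ Icc (0 : ℝ) 1, MeasurableSet S → ∫ θ in S, (terms S).q θ ∂(law f) ≤ 0

/-- The agents' market choices: the types joining the marketplace and the types joining the search
market. All other types in `[0,1]` join neither. -/
structure Segmentation where
  market : Set ℝ
  search : Set ℝ
  market_subset : market ⊆ Icc 0 1
  search_subset : search ⊆ Icc 0 1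
  measurableSet_market : MeasurableSet market
  measurableSet_search : MeasurableSet search
  disjoint : Disjoint market search

/-- The profit: total payments of those who join the marketplace. -/
def profit (f : ℝ → ℝ) (A : Announcement f) (s : Segmentation) : ℝ :=
  ∫ θ in s.market, (A.terms s.market).t θ ∂(law f)

/-! ### Payoffs -/

/-- Expected net payoff of type `θ` in the search market joined by `D`: with probability `p` the
agent meets a type `x` drawn from `D`, and each of the two gets half of the surplus `|x - θ|`.
It is `0` if `D` is a null set, since then there is nobody to meet. -/
def searchPayoff (f : ℝ → ℝ) (p : ℝ) (D : Set ℝ) (θ : ℝ) : ℝ :=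
  p * ⨍ x in D, |x - θ| / 2 ∂(law f)

open Classical in
/-- Net payoff of type `θ` in the marketplace, alone or as one of the joining types. One agent does
not affect the operated mechanism; if only a null set of agents joins, there is nobody to trade
with. -/
def marketPayoff (f : ℝ → ℝ) (A : Announcement f) (s : Segmentation) (θ : ℝ) : ℝ :=
  if law f s.market = 0 then 0 else (A.terms s.market).utility θ

open Classical in
/-- Payoff of type `θ` under the segmentation `s`. -/
def payoff (f : ℝ → ℝ) (p : ℝ) (A : Announcement f) (s : Segmentation) (θ : ℝ) : ℝ :=
  if θ ∈ s.market then marketPayoff f A s θ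
  else if θ ∈ s.search then searchPayoff f p s.search θ
  else 0

open Classical in
/-- Payoff of type `θ` after moving to the search market together with an agent of type `θ'`. If the
search market is otherwise null, the two can only meet each other; if not, they almost surely meet
somebody else. -/
def pairSearchPayoff (f : ℝ → ℝ) (p : ℝ) (s : Segmentation) (θ θ' : ℝ) : ℝ :=
  if law f s.search = 0 then p * (|θ' - θ| / 2) else searchPayoff f p s.search θ

open Classical in
/-- Payoff of type `θ` after moving to the marketplace together with an agent of type `θ'`. If the
marketplace is otherwise null, they get the announced terms if these make the two trade with each
other, and the marketplace shuts down if the quantities do not match. -/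
def pairMarketPayoff (f : ℝ → ℝ) (A : Announcement f) (s : Segmentation) (θ θ' : ℝ) : ℝ :=
  if law f s.market = 0 then
    if (A.terms s.market).q θ + (A.terms s.market).q θ' = 0 then (A.terms s.market).utility θ
    else 0
  else (A.terms s.market).utility θ

/-! ### Equilibrium -/

/-- Two agents outside the search market both gain strictly by moving there together. -/
def HasPairDeviationToSearch (f : ℝ → ℝ) (p : ℝ) (A : Announcement f) (s : Segmentation) : Prop :=
  ∃ θ ∈ Icc (0 : ℝ) 1, ∃ θ' ∈ Icc (0 : ℝ) 1, θ ≠ θ' ∧ θ ∉ s.search ∧ θ' ∉ s.search ∧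
    payoff f p A s θ < pairSearchPayoff f p s θ θ' ∧
    payoff f p A s θ' < pairSearchPayoff f p s θ' θ

/-- Two agents outside the marketplace both gain strictly by moving there together. -/
def HasPairDeviationToMarket (f : ℝ → ℝ) (p : ℝ) (A : Announcement f) (s : Segmentation) : Prop :=
  ∃ θ ∈ Icc (0 : ℝ) 1, ∃ θ' ∈ Icc (0 : ℝ) 1, θ ≠ θ' ∧ θ ∉ s.market ∧ θ' ∉ s.market ∧
    payoff f p A s θ < pairMarketPayoff f A s θ θ' ∧
    payoff f p A s θ' < pairMarketPayoff f A s θ' θ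

/-- Equilibrium of the subgame after the announcement `A`, without bilateral deviations. -/
structure IsSubgameEquilibrium (f : ℝ → ℝ) (p : ℝ) (A : Announcement f) (s : Segmentation) :
    Prop where
  neither_le : ∀ θ ∈ Icc (0 : ℝ) 1, 0 ≤ payoff f p A s θ
  market_le : ∀ θ ∈ Icc (0 : ℝ) 1, marketPayoff f A s θ ≤ payoff f p A s θ
  search_le : ∀ θ ∈ Icc (0 : ℝ) 1, searchPayoff f p s.search θ ≤ payoff f p A s θ
  no_pair_to_search : ¬ HasPairDeviationToSearch f p A s
  no_pair_to_market : ¬ HasPairDeviationToMarket f p A s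

/-- The designer may announce what leads to a subgame with at least one equilibrium. -/
def Announcement.Admissible {f : ℝ → ℝ} (p : ℝ) (A : Announcement f) : Prop :=
  ∃ s, IsSubgameEquilibrium f p A s

/-- A strategy of the designer and a strategy of the agents. -/
structure StrategyProfile (f : ℝ → ℝ) where
  announcement : Announcement f
  response : Announcement f → Segmentation

/-- The segmentation on the path of play. -/
def StrategyProfile.outcome {f : ℝ → ℝ} (e : StrategyProfile f) : Segmentation :=
  e.response e.announcement

/-- The mechanism operated on the path of play. -/
def StrategyProfile.mechanism {f : ℝ → ℝ} (e : StrategyProfile f) : DirectMechanism :=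
  e.announcement.terms e.outcome.market

/-- Subgame perfect equilibrium without bilateral deviations. -/
structure IsEquilibrium (f : ℝ → ℝ) (p : ℝ) (e : StrategyProfile f) : Prop where
  admissible : e.announcement.Admissible p
  subgame : ∀ A : Announcement f, A.Admissible p → IsSubgameEquilibrium f p A (e.response A)
  optimal : ∀ A : Announcement f, A.Admissible p →
    profit f A (e.response A) ≤ profit f e.announcement e.outcome

/-- Cutoffs of coexistence: interior, with as many buyers as sellers in the marketplace, and with
the virtual cost of the marginal seller equal to the virtual value of the marginal buyer. -/
structure IsCutoffPair (f : ℝ → ℝ) (a b : ℝ) : Prop where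
  pos : 0 < a
  lt : a < b
  lt_one : b < 1
  clearing : cdf f a = 1 - cdf f b
  marginal : virtualCost f a = virtualValue f b

/-- Almost all agents choose as in the simple segmentation with cutoffs `a` and `b`: the types in
`[0,a] ∪ [b,1]` join the marketplace and those in `(a,b)` join the search market. -/
def IsAESimple (f : ℝ → ℝ) (s : Segmentation) (a b : ℝ) : Prop :=
  s.market =ᵐ[law f] (Icc 0 a ∪ Icc b 1 : Set ℝ) ∧ s.search =ᵐ[law f] Ioo a b

/-- Almost all agents join the same market in both profiles, and almost all who join the marketplace
trade the same quantity and pay the same transfer there. -/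
def SameOutcome {f : ℝ → ℝ} (e e' : StrategyProfile f) : Prop :=
  e.outcome.market =ᵐ[law f] e'.outcome.market ∧
  e.outcome.search =ᵐ[law f] e'.outcome.search ∧
  ∀ᵐ θ ∂(law f), θ ∈ e.outcome.market →
    e.mechanism.q θ = e'.mechanism.q θ ∧ e.mechanism.t θ = e'.mechanism.t θ

end MarketChoice

end

/-! The designer's equilibrium profit is pinned down by an upper bound and an announcement that
secures it whatever the agents' response.

Upper bound. If `θ < θ'` both join the marketplace, their payoffs sum to at least `p / 2 * (θ' -
θ)`: either the search market is active and each could move there alone, or it is null and they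
could move there together (`le_payoff_add`). So with `c` the highest seller and `d` the lowest
buyer, the price spread is at most `(1 - p / 2) * (d - c)`. The volume is at most `F c` and `1 - F
d`, hence profit is at most `1 - p / 2` times the maximum of `F a * (b - a)` over market clearing
pairs (`TradeData.profit_le`). The first-order condition of this maximization is that virtual cost
at `a` equals virtual value at `b` (`isCutoffPair`).

Attainment. `IsOptimalPair.announcement` operates only if essentially the types outside `(a, b)`
join, and every other segmentation is upset by some pair (`market_ae_eq_outside`). So the designer
gets the bound in every equilibrium.

Rigidity. Equality in the bound forces all types beyond `c` and `d` to trade, almost all types in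
between to search, and both cutoff types to be indifferent (`exists_of_le_profit`). Simple
coexistence follows, and with it the impossibility of a single market. -/

namespace MarketChoice

open Filter Topology

variable {f : ℝ → ℝ}

/-! ### The distribution of valuations -/

namespace IsValuationDensity

lemma integrableOn (hf : IsValuationDensity f) : IntegrableOn f (Ioo 0 1) := by
  by_contra h
  have := hf.integral_eq_one
  rw [integral_undef h] at this
  exact zero_ne_one this

lemma ae_nonneg (hf : IsValuationDensity f) : 0 ≤ᵐ[volume.restrict (Ioo 0 1)] f := by
  filter_upwards [ae_restrict_mem measurableSet_Ioo] with x hx using (hf.pos x hx).le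

/-- Since `f` is arbitrary outside `(0,1)`, it is extended by zero through `indicator`, so that
primitives over the whole line are available. -/
lemma law_apply (hf : IsValuationDensity f) {s : Set ℝ} (hs : MeasurableSet s) :
    law f s = ENNReal.ofReal (∫ θ in s, (Ioo 0 1).indicator f θ) := by
  rw [law, withDensity_apply _ hs, setIntegral_indicator measurableSet_Ioo,
    ← Measure.restrict_restrict hs, ofReal_integral_eq_lintegral_ofReal]
  · exact Integrable.mono_measure hf.integrableOn Measure.restrict_le_self
  · exact ae_restrict_of_ae hf.ae_nonneg

lemma indicator_nonneg (hf : IsValuationDensity f) (θ : ℝ) : 0 ≤ (Ioo 0 1).indicator f θ :=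
  Set.indicator_nonneg (fun x hx => (hf.pos x hx).le) θ

lemma integrable_indicator (hf : IsValuationDensity f) : Integrable ((Ioo 0 1).indicator f) :=
  (integrable_indicator_iff measurableSet_Ioo).2 hf.integrableOn

lemma law_real (hf : IsValuationDensity f) {s : Set ℝ} (hs : MeasurableSet s) :
    (law f).real s = ∫ θ in s, (Ioo 0 1).indicator f θ := by
  rw [Measure.real, hf.law_apply hs, ENNReal.toReal_ofReal]
  exact integral_nonneg hf.indicator_nonneg

lemma isProbabilityMeasure (hf : IsValuationDensity f) : IsProbabilityMeasure (law f) := by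
  constructor
  rw [hf.law_apply MeasurableSet.univ, setIntegral_indicator measurableSet_Ioo, univ_inter,
    hf.integral_eq_one, ENNReal.ofReal_one]

lemma law_absolutelyContinuous : law f ≪ volume.restrict (Ioo 0 1) :=
  withDensity_absolutelyContinuous _ _

lemma law_singleton (x : ℝ) : law f {x} = 0 :=
  law_absolutelyContinuous (Measure.absolutelyContinuous_of_le Measure.restrict_le_self
    (Real.volume_singleton))

lemma ae_mem_Ioo : ∀ᵐ θ ∂(law f), θ ∈ Ioo (0 : ℝ) 1 :=
  law_absolutelyContinuous.ae_le (ae_restrict_mem measurableSet_Ioo)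

lemma law_Ioo_pos (hf : IsValuationDensity f) {x y : ℝ} (hx : 0 ≤ x) (hxy : x < y) (hy : y ≤ 1) :
    0 < law f (Ioo x y) := by
  rw [hf.law_apply measurableSet_Ioo, ENNReal.ofReal_pos,
    setIntegral_pos_iff_support_of_nonneg_ae (ae_of_all _ hf.indicator_nonneg)
      hf.integrable_indicator.integrableOn]
  have : Ioo x y ⊆ Function.support ((Ioo 0 1).indicator f) ∩ Ioo x y := by
    intro z hz
    have hz' : z ∈ Ioo (0 : ℝ) 1 := ⟨hx.trans_lt hz.1, hz.2.trans_le hy⟩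
    refine ⟨?_, hz⟩
    rw [Function.mem_support, indicator_of_mem hz']
    exact (hf.pos z hz').ne'
  refine lt_of_lt_of_le ?_ (measure_mono this)
  rw [Real.volume_Ioo]
  simpa using hxy

lemma cdf_eq (hf : IsValuationDensity f) (θ : ℝ) :
    cdf f θ = ∫ x in (0 : ℝ)..θ, (Ioo 0 1).indicator f x := by
  rw [← intervalIntegral.integral_Iic_sub_Iic hf.integrable_indicator.integrableOn
    hf.integrable_indicator.integrableOn, cdf, hf.law_real measurableSet_Iic]
  have : ∫ x in Iic (0 : ℝ), (Ioo 0 1).indicator f x = 0 := by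
    rw [setIntegral_indicator measurableSet_Ioo]
    have : Iic (0 : ℝ) ∩ Ioo 0 1 = ∅ := by
      ext z
      simp only [mem_inter_iff, mem_Iic, mem_Ioo, mem_empty_iff_false, iff_false]
      intro h
      linarith [h.1, h.2.1]
    simp [this]
  rw [this, sub_zero]

lemma continuous_cdf (hf : IsValuationDensity f) : Continuous (cdf f) := by
  rw [show cdf f = _ from funext hf.cdf_eq]
  exact intervalIntegral.continuous_primitive
    (fun _ _ => hf.integrable_indicator.intervalIntegrable) 0

/-- Strict differentiability is what the Lagrange multiplier theorem in `isCutoffPair` needs. -/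
lemma hasStrictDerivAt_cdf (hf : IsValuationDensity f) {θ : ℝ} (hθ : θ ∈ Ioo (0 : ℝ) 1) :
    HasStrictDerivAt (cdf f) (f θ) θ := by
  rw [show cdf f = _ from funext hf.cdf_eq]
  have hnhds : Ioo (0 : ℝ) 1 ∈ 𝓝 θ := isOpen_Ioo.mem_nhds hθ
  have heq : (Ioo 0 1).indicator f =ᶠ[𝓝 θ] f := by
    filter_upwards [hnhds] with x hx using indicator_of_mem hx f
  rw [← indicator_of_mem hθ f]
  refine intervalIntegral.integral_hasStrictDerivAt_right
    hf.integrable_indicator.intervalIntegrable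
    hf.integrable_indicator.aestronglyMeasurable.stronglyMeasurableAtFilter ?_
  exact (hf.continuousOn.continuousAt hnhds).congr heq.symm

lemma cdf_zero (hf : IsValuationDensity f) : cdf f 0 = 0 := by
  rw [hf.cdf_eq, intervalIntegral.integral_same]

lemma law_real_Ioc (hf : IsValuationDensity f) {x y : ℝ} (hxy : x ≤ y) :
    (law f).real (Ioc x y) = cdf f y - cdf f x := by
  rw [hf.law_real measurableSet_Ioc, ← intervalIntegral.integral_of_le hxy, hf.cdf_eq, hf.cdf_eq,
    intervalIntegral.integral_interval_sub_left] <;>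
  exact hf.integrable_indicator.intervalIntegrable

lemma nullSingletonClass (_hf : IsValuationDensity f) : NullSingletonClass (law f) :=
  ⟨law_singleton⟩

lemma cdf_one (hf : IsValuationDensity f) : cdf f 1 = 1 := by
  have h := hf.law_real_Ioc zero_le_one
  have := hf.isProbabilityMeasure
  rw [hf.cdf_zero, sub_zero] at h
  rw [← h, measureReal_def, (prob_compl_eq_zero_iff measurableSet_Ioc).1, ENNReal.toReal_one]
  exact measure_mono_null (compl_subset_compl.2 Ioo_subset_Ioc_self) ae_mem_Ioo

lemma strictMonoOn_cdf (hf : IsValuationDensity f) : StrictMonoOn (cdf f) (Icc 0 1) := by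
  intro x hx y hy hxy
  have := hf.isProbabilityMeasure
  have h := hf.law_real_Ioc hxy.le
  have h1 : 0 < (law f).real (Ioc x y) :=
    ENNReal.toReal_pos ((hf.law_Ioo_pos hx.1 hxy hy.2).trans_le
      (measure_mono Ioo_subset_Ioc_self)).ne' (measure_ne_top _ _)
  linarith

lemma law_real_Icc (hf : IsValuationDensity f) {x y : ℝ} (hxy : x ≤ y) :
    (law f).real (Icc x y) = cdf f y - cdf f x := by
  have := hf.nullSingletonClass
  rw [← hf.law_real_Ioc hxy]
  exact measureReal_congr Ioc_ae_eq_Icc.symm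

lemma law_real_Icc_zero (hf : IsValuationDensity f) {x : ℝ} (hx : 0 ≤ x) :
    (law f).real (Icc 0 x) = cdf f x := by
  rw [hf.law_real_Icc hx, hf.cdf_zero, sub_zero]

lemma law_real_Icc_one (hf : IsValuationDensity f) {x : ℝ} (hx : x ≤ 1) :
    (law f).real (Icc x 1) = 1 - cdf f x := by
  rw [hf.law_real_Icc hx, hf.cdf_one]

lemma exists_cdf_eq (hf : IsValuationDensity f) {x y c : ℝ} (hxy : x ≤ y)
    (hc : c ∈ Icc (cdf f x) (cdf f y)) : ∃ z ∈ Icc x y, cdf f z = c :=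
  intermediate_value_Icc hxy hf.continuous_cdf.continuousOn hc

end IsValuationDensity

/-! ### Optimal cutoffs -/

/-- The market clearing pairs of cutoffs that maximize the volume of trade times the spread between
the marginal buyer and the marginal seller. -/
structure IsOptimalPair (f : ℝ → ℝ) (a b : ℝ) : Prop where
  left_mem : a ∈ Icc (0 : ℝ) 1
  right_mem : b ∈ Icc (0 : ℝ) 1
  clearing : cdf f a + cdf f b = 1
  isMax : ∀ a' ∈ Icc (0 : ℝ) 1, ∀ b' ∈ Icc (0 : ℝ) 1, cdf f a' + cdf f b' = 1 →
    cdf f a' * (b' - a') ≤ cdf f a * (b - a)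

lemma exists_isOptimalPair (hf : IsValuationDensity f) : ∃ a b, IsOptimalPair f a b := by
  have hF := hf.continuous_cdf
  have hK : IsCompact ((Icc (0 : ℝ) 1 ×ˢ Icc (0 : ℝ) 1) ∩ {x : ℝ × ℝ | cdf f x.1 + cdf f x.2 = 1}) :=
    (isCompact_Icc.prod isCompact_Icc).inter_right
      (isClosed_eq (by fun_prop) continuous_const)
  have hne : ((Icc (0 : ℝ) 1 ×ˢ Icc (0 : ℝ) 1) ∩
      {x : ℝ × ℝ | cdf f x.1 + cdf f x.2 = 1}).Nonempty :=
    ⟨(0, 1), by simp [hf.cdf_zero, hf.cdf_one]⟩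
  have hcont : Continuous fun x : ℝ × ℝ => cdf f x.1 * (x.2 - x.1) := by fun_prop
  obtain ⟨⟨a, b⟩, hx, hmax⟩ := hK.exists_isMaxOn hne hcont.continuousOn
  rw [isMaxOn_iff] at hmax
  refine ⟨a, b, hx.1.1, hx.1.2, hx.2, fun a' ha' b' hb' h => ?_⟩
  exact hmax (a', b') (mem_inter (mk_mem_prod ha' hb') h)

namespace IsOptimalPair

variable {a b : ℝ}

lemma value_pos (hf : IsValuationDensity f) (h : IsOptimalPair f a b) :
    0 < cdf f a * (b - a) := by
  -- The lower and upper quartiles clear the market with a positive spread.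
  obtain ⟨x, hx, hx'⟩ := hf.exists_cdf_eq (x := 0) (y := 1) (c := 1 / 4) zero_le_one
    (by rw [hf.cdf_zero, hf.cdf_one]; norm_num)
  obtain ⟨y, hy, hy'⟩ := hf.exists_cdf_eq (x := 0) (y := 1) (c := 3 / 4) zero_le_one
    (by rw [hf.cdf_zero, hf.cdf_one]; norm_num)
  have hxy : x < y := (hf.strictMonoOn_cdf.lt_iff_lt hx hy).1 (by rw [hx', hy']; norm_num)
  refine lt_of_lt_of_le ?_ (h.isMax x hx y hy (by rw [hx', hy']; norm_num))
  rw [hx']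
  linarith

lemma cdf_nonneg (f : ℝ → ℝ) (x : ℝ) : 0 ≤ cdf f x := measureReal_nonneg

lemma pos (hf : IsValuationDensity f) (h : IsOptimalPair f a b) : 0 < a := by
  refine h.left_mem.1.lt_of_ne' fun h0 => ?_
  have := h.value_pos hf
  rw [h0, hf.cdf_zero, zero_mul] at this
  exact this.false

lemma lt (hf : IsValuationDensity f) (h : IsOptimalPair f a b) : a < b := by
  have := pos_of_mul_pos_right (h.value_pos hf) (cdf_nonneg f a)
  linarith

lemma lt_one (hf : IsValuationDensity f) (h : IsOptimalPair f a b) : b < 1 := by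
  refine h.right_mem.2.lt_of_ne fun h1 => ?_
  have := h.value_pos hf
  have hc := h.clearing
  rw [h1, hf.cdf_one] at hc
  rw [show cdf f a = 0 by linarith, zero_mul] at this
  exact this.false

/-- Positive value makes the pair interior, so Lagrange multipliers apply. Eliminating them gives `b
- a = F a / f a + F a / f b`, which is the marginal condition because `F a = 1 - F b`. -/
lemma isCutoffPair (hf : IsValuationDensity f) (h : IsOptimalPair f a b) : IsCutoffPair f a b := by
  have ha : a ∈ Ioo (0 : ℝ) 1 := ⟨h.pos hf, (h.lt hf).trans (h.lt_one hf)⟩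
  have hb : b ∈ Ioo (0 : ℝ) 1 := ⟨(h.pos hf).trans (h.lt hf), h.lt_one hf⟩
  have hc := h.clearing
  refine ⟨h.pos hf, h.lt hf, h.lt_one hf, by linarith, ?_⟩
  have hFa : HasStrictFDerivAt (fun x : ℝ × ℝ => cdf f x.1)
      ((f a) • ContinuousLinearMap.fst ℝ ℝ ℝ) (a, b) :=
    HasStrictDerivAt.comp_hasStrictFDerivAt (h₂ := cdf f) (f := Prod.fst) (a, b)
      (hf.hasStrictDerivAt_cdf ha) hasStrictFDerivAt_fst
  have hFb : HasStrictFDerivAt (fun x : ℝ × ℝ => cdf f x.2)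
      ((f b) • ContinuousLinearMap.snd ℝ ℝ ℝ) (a, b) :=
    HasStrictDerivAt.comp_hasStrictFDerivAt (h₂ := cdf f) (f := Prod.snd) (a, b)
      (hf.hasStrictDerivAt_cdf hb) hasStrictFDerivAt_snd
  have hext : IsLocalExtrOn (fun x : ℝ × ℝ => cdf f x.1 * (x.2 - x.1))
      {x | cdf f x.1 + cdf f x.2 = cdf f (a, b).1 + cdf f (a, b).2} (a, b) := by
    refine Or.inr ?_
    have hn : Icc (0 : ℝ) 1 ×ˢ Icc (0 : ℝ) 1 ∈ 𝓝 (a, b) :=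
      prod_mem_nhds (Icc_mem_nhds ha.1 ha.2) (Icc_mem_nhds hb.1 hb.2)
    filter_upwards [mem_nhdsWithin_of_mem_nhds hn, self_mem_nhdsWithin] with x hx hx'
    exact h.isMax _ hx.1 _ hx.2 (hx'.trans hc)
  obtain ⟨Λ, Λ₀, hne, heq⟩ := hext.exists_multipliers_of_hasStrictFDerivAt_1d (hFa.add hFb)
    (hFa.mul (hasStrictFDerivAt_snd.sub hasStrictFDerivAt_fst))
  have h1 := DFunLike.congr_fun heq (1, 0)
  have h2 := DFunLike.congr_fun heq (0, 1)
  simp at h1 h2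
  have hfa := hf.pos a ha
  have hfb := hf.pos b hb
  -- The constraint is nondegenerate: its partial derivative in `b` is `f b > 0`, so a vanishing
  -- `Λ₀` would make both multipliers vanish.
  have hΛ₀ : Λ₀ ≠ 0 := by
    rintro rfl
    apply hne
    simp [hfb.ne'] at h2
    simp [h2]
  rw [virtualCost, virtualValue, ← show cdf f a = 1 - cdf f b by linarith]
  have h3 : Λ = -(Λ₀ * cdf f a / f b) := by
    field_simp
    linarith
  rw [h3] at h1
  have h4 : Λ₀ * (-(cdf f a / f b) + (b - a) - cdf f a / f a) = 0 := by
    have : Λ₀ * (-(cdf f a / f b) + (b - a) - cdf f a / f a) * f a = 0 := by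
      field_simp
      field_simp at h1
      linarith
    exact (mul_eq_zero.1 this).resolve_right hfa.ne'
  have h5 := (mul_eq_zero.1 h4).resolve_left hΛ₀
  linarith

/-- A volume `y` traded at a spread of `d - c`, with enough types below `c` and above `d`, is worth
at most the optimum, and it is worth as much only if all types beyond `c` and `d` trade. -/
lemma le_value (hf : IsValuationDensity f) (h : IsOptimalPair f a b) {c d y : ℝ}
    (hc : c ∈ Icc (0 : ℝ) 1) (hd : d ∈ Icc (0 : ℝ) 1) (hy : 0 ≤ y) (hyc : y ≤ cdf f c)
    (hyd : y ≤ 1 - cdf f d) :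
    y * (d - c) ≤ cdf f a * (b - a) ∧
      (cdf f a * (b - a) ≤ y * (d - c) →
        IsOptimalPair f c d ∧ y = cdf f c ∧ y = 1 - cdf f d) := by
  -- Serving the same volume with the most extreme types moves the cutoffs outward to the quantiles
  -- of `y`, which widens the spread. Equality then leaves no room to move.
  obtain ⟨c', hc', hyc'⟩ := hf.exists_cdf_eq hc.1 (c := y) (by rw [hf.cdf_zero]; exact ⟨hy, hyc⟩)
  obtain ⟨d', hd', hyd'⟩ := hf.exists_cdf_eq hd.2 (c := 1 - y)
    (by rw [hf.cdf_one]; constructor <;> linarith)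
  have hc1 : c' ∈ Icc (0 : ℝ) 1 := ⟨hc'.1, hc'.2.trans hc.2⟩
  have hd1 : d' ∈ Icc (0 : ℝ) 1 := ⟨hd.1.trans hd'.1, hd'.2⟩
  have h1 := h.isMax c' hc1 d' hd1 (by rw [hyc', hyd']; ring)
  rw [hyc'] at h1
  have h2 : y * (d - c) ≤ y * (d' - c') :=
    mul_le_mul_of_nonneg_left (by linarith [hc'.2, hd'.1]) hy
  refine ⟨h2.trans h1, fun hle => ?_⟩
  have hy0 : 0 < y := by
    refine hy.lt_of_ne' fun h0 => ?_
    have := h.value_pos hf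
    rw [h0, zero_mul] at hle
    linarith
  have h3 : d' - c' ≤ d - c := le_of_mul_le_mul_left (h1.trans hle) hy0
  have hcc : c' = c := by linarith [hc'.2, hd'.1]
  have hdd : d' = d := by linarith [hc'.2, hd'.1]
  subst hcc hdd
  refine ⟨⟨hc, hd, by linarith, fun a' ha' b' hb' h' => ?_⟩, hyc'.symm, by linarith⟩
  rw [hyc']
  exact (h.isMax a' ha' b' hb' h').trans hle

end IsOptimalPair

/-- By clearing, raising the lower cutoff lowers the upper one. Virtual cost then rises weakly and
virtual value falls weakly, one of them strictly, so the marginal condition cannot hold at both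
pairs. -/
lemma IsCutoffPair.unique (hf : IsValuationDensity f) (hreg : IsRegular f)
    (hs : StrictMonoOn (virtualValue f) (Ioo 0 1) ∨ StrictMonoOn (virtualCost f) (Ioo 0 1))
    {a b c d : ℝ} (h : IsCutoffPair f a b) (h' : IsCutoffPair f c d) : a = c ∧ b = d := by
  have key : ∀ {a b c d : ℝ}, IsCutoffPair f a b → IsCutoffPair f c d → ¬ a < c := by
    intro a b c d h h' hac
    have ha : a ∈ Ioo (0 : ℝ) 1 := ⟨h.pos, h.lt.trans h.lt_one⟩
    have hb : b ∈ Ioo (0 : ℝ) 1 := ⟨h.pos.trans h.lt, h.lt_one⟩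
    have hc : c ∈ Ioo (0 : ℝ) 1 := ⟨h'.pos, h'.lt.trans h'.lt_one⟩
    have hd : d ∈ Ioo (0 : ℝ) 1 := ⟨h'.pos.trans h'.lt, h'.lt_one⟩
    have hF := hf.strictMonoOn_cdf (Ioo_subset_Icc_self ha) (Ioo_subset_Icc_self hc) hac
    have hdb : d < b := (hf.strictMonoOn_cdf.lt_iff_lt (Ioo_subset_Icc_self hd)
      (Ioo_subset_Icc_self hb)).1 (by linarith [h.clearing, h'.clearing])
    have h1 := hreg.virtualCost_mono ha hc hac.le
    have h2 := hreg.virtualValue_mono hd hb hdb.le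
    have h3 := h.marginal
    have h4 := h'.marginal
    rcases hs with hs | hs
    · linarith [hs hd hb hdb]
    · linarith [hs ha hc hac]
  have hac : a = c := le_antisymm (not_lt.1 (key h' h)) (not_lt.1 (key h h'))
  refine ⟨hac, hf.strictMonoOn_cdf.injOn ⟨(h.pos.trans h.lt).le, h.lt_one.le⟩
    ⟨(h'.pos.trans h'.lt).le, h'.lt_one.le⟩ ?_⟩
  have h1 := h.clearing
  have h2 := h'.clearing
  rw [hac] at h1
  linarith

variable {p : ℝ}

/-! ### The search market -/

lemma searchPayoff_of_null (p : ℝ) {D : Set ℝ} (hD : law f D = 0) (θ : ℝ) :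
    searchPayoff f p D θ = 0 := by
  rw [searchPayoff, setAverage_eq, measureReal_def, hD]
  simp

lemma searchPayoff_congr (p : ℝ) {D E : Set ℝ} (h : D =ᵐ[law f] E) (θ : ℝ) :
    searchPayoff f p D θ = searchPayoff f p E θ := by
  rw [searchPayoff, searchPayoff, setAverage_congr h]

lemma searchPayoff_eq (f : ℝ → ℝ) (p : ℝ) (D : Set ℝ) (θ : ℝ) :
    searchPayoff f p D θ = p * (((law f).real D)⁻¹ * ∫ x in D, |x - θ| / 2 ∂(law f)) := by
  rw [searchPayoff, setAverage_eq, smul_eq_mul]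

lemma IsValuationDensity.law_real_pos (hf : IsValuationDensity f) {D : Set ℝ}
    (hD : law f D ≠ 0) : 0 < (law f).real D := by
  have := hf.isProbabilityMeasure
  exact ENNReal.toReal_pos hD (measure_ne_top _ _)

lemma IsValuationDensity.integrable_abs_sub (hf : IsValuationDensity f) (θ : ℝ) :
    Integrable (fun x => |x - θ| / 2) (law f) := by
  have := hf.isProbabilityMeasure
  refine Integrable.of_bound (by fun_prop) ((1 + |θ|) / 2) ?_
  filter_upwards [IsValuationDensity.ae_mem_Ioo (f := f)] with x hx
  rw [Real.norm_eq_abs, abs_of_nonneg (by positivity)]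
  have := abs_sub x θ
  rw [abs_of_pos hx.1] at this
  linarith [hx.2]

lemma searchPayoff_pos (hf : IsValuationDensity f) (hp : 0 < p) {D : Set ℝ} (hD : law f D ≠ 0)
    (θ : ℝ) : 0 < searchPayoff f p D θ := by
  rw [searchPayoff_eq]
  refine mul_pos hp (mul_pos (inv_pos.2 (hf.law_real_pos hD)) ?_)
  rw [setIntegral_pos_iff_support_of_nonneg_ae (ae_of_all _ fun x => by positivity)
    (hf.integrable_abs_sub θ).integrableOn]
  refine (pos_iff_ne_zero.2 hD).trans_le ?_
  have : D ⊆ (Function.support (fun x => |x - θ| / 2) ∩ D) ∪ {θ} := by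
    intro x hx
    by_cases h : x = θ
    · exact Or.inr h
    · refine Or.inl ⟨?_, hx⟩
      simp [sub_ne_zero.2 h]
  calc law f D ≤ _ := measure_mono this
    _ ≤ _ := measure_union_le _ _
    _ = _ := by rw [IsValuationDensity.law_singleton, add_zero]

/-- Search payoffs have slope at most `1 / 2`, whereas traders' utility in the marketplace has slope
`±1`; this gives single crossing at the cutoffs. -/
lemma searchPayoff_le_add (hf : IsValuationDensity f) (hp0 : 0 < p) (hp1 : p ≤ 1) (D : Set ℝ)
    (θ θ' : ℝ) : searchPayoff f p D θ ≤ searchPayoff f p D θ' + |θ - θ'| / 2 := by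
  by_cases hD : law f D = 0
  · rw [searchPayoff_of_null p hD, searchPayoff_of_null p hD]
    positivity
  have := hf.isProbabilityMeasure
  have hpos := hf.law_real_pos hD
  have h1 : ∫ x in D, |x - θ| / 2 ∂(law f) ≤
      ∫ x in D, |x - θ'| / 2 ∂(law f) + (law f).real D * (|θ - θ'| / 2) := by
    rw [← smul_eq_mul ((law f).real D), ← setIntegral_const,
      ← integral_add (hf.integrable_abs_sub θ').integrableOn (integrable_const _)]
    refine integral_mono (hf.integrable_abs_sub θ).integrableOn
      ((hf.integrable_abs_sub θ').integrableOn.add (integrable_const _)) fun x => ?_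
    have := abs_sub_le x θ' θ
    rw [abs_sub_comm θ' θ] at this
    simp only
    linarith
  have h2 := mul_le_mul_of_nonneg_left h1 (inv_pos.2 hpos).le
  rw [mul_add, inv_mul_cancel_left₀ hpos.ne'] at h2
  rw [searchPayoff_eq, searchPayoff_eq]
  have h3 : p * (|θ - θ'| / 2) ≤ |θ - θ'| / 2 := mul_le_of_le_one_left (by positivity) hp1
  linarith [mul_le_mul_of_nonneg_left h2 hp0.le]

lemma continuous_searchPayoff (hf : IsValuationDensity f) (hp0 : 0 < p) (hp1 : p ≤ 1)
    (D : Set ℝ) : Continuous (searchPayoff f p D) := by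
  refine (LipschitzWith.of_le_add fun x y => ?_).continuous
  rw [Real.dist_eq]
  linarith [searchPayoff_le_add hf hp0 hp1 D x y, abs_nonneg (x - y)]

lemma searchPayoff_add (hf : IsValuationDensity f) (p : ℝ) (D : Set ℝ) (θ θ' : ℝ) :
    searchPayoff f p D θ + searchPayoff f p D θ' =
      p * (((law f).real D)⁻¹ * ∫ x in D, (|x - θ| / 2 + |x - θ'| / 2) ∂(law f)) := by
  rw [integral_add (hf.integrable_abs_sub θ).integrableOn (hf.integrable_abs_sub θ').integrableOn,
    searchPayoff_eq, searchPayoff_eq]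
  ring

/-- Triangle inequality, for each possible partner `x`. -/
lemma le_searchPayoff_add (hf : IsValuationDensity f) (hp : 0 < p) {D : Set ℝ}
    (hD : law f D ≠ 0) (θ θ' : ℝ) :
    p / 2 * (θ' - θ) ≤ searchPayoff f p D θ + searchPayoff f p D θ' := by
  have := hf.isProbabilityMeasure
  have hpos := hf.law_real_pos hD
  have h1 : (law f).real D * ((θ' - θ) / 2) ≤
      ∫ x in D, (|x - θ| / 2 + |x - θ'| / 2) ∂(law f) := by
    rw [← smul_eq_mul, ← setIntegral_const]
    refine integral_mono (integrable_const _) ((hf.integrable_abs_sub θ).integrableOn.add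
      (hf.integrable_abs_sub θ').integrableOn) fun x => ?_
    linarith [le_abs_self (x - θ), neg_abs_le (x - θ')]
  have h2 := mul_le_mul_of_nonneg_left h1 (inv_pos.2 hpos).le
  rw [inv_mul_cancel_left₀ hpos.ne'] at h2
  rw [searchPayoff_add hf]
  linarith [mul_le_mul_of_nonneg_left h2 hp.le]

/-- The triangle inequality is tight because every partner lies between `a` and `b`. -/
lemma searchPayoff_Ioo_add (hf : IsValuationDensity f) (p : ℝ) {a b : ℝ} (ha : 0 ≤ a)
    (hab : a < b) (hb : b ≤ 1) :
    searchPayoff f p (Ioo a b) a + searchPayoff f p (Ioo a b) b = p / 2 * (b - a) := by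
  have hpos := hf.law_real_pos (hf.law_Ioo_pos ha hab hb).ne'
  rw [searchPayoff_add hf, setIntegral_congr_fun (g := fun _ => (b - a) / 2) measurableSet_Ioo,
    setIntegral_const, smul_eq_mul, inv_mul_cancel_left₀ hpos.ne']
  · ring
  · intro x hx
    simp only
    rw [abs_of_pos (sub_pos.2 hx.1), abs_of_neg (sub_neg.2 hx.2)]
    ring

/-! ### Direct mechanisms -/

namespace DirectMechanism

variable (m : DirectMechanism)

lemma monotoneOn_q : MonotoneOn m.q (Icc 0 1) := by
  intro θ hθ r hr h
  rcases h.eq_or_lt with rfl | h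
  · exact le_rfl
  have h1 := m.incentiveCompatible θ hθ r hr
  have h2 := m.incentiveCompatible r hr θ hθ
  have h3 : 0 ≤ (r - θ) * (m.q r - m.q θ) := by linarith
  have := nonneg_of_mul_nonneg_right h3 (sub_pos.2 h)
  linarith

/-- The transfer depends on the report only through the quantity. -/
lemma exists_price : ∃ τ : ℝ → ℝ, ∀ θ ∈ Icc (0 : ℝ) 1, m.t θ = τ (m.q θ) := by
  classical
  refine ⟨fun k => if h : ∃ r ∈ Icc (0 : ℝ) 1, m.q r = k then m.t h.choose else 0,
    fun θ hθ => ?_⟩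
  have h : ∃ r ∈ Icc (0 : ℝ) 1, m.q r = m.q θ := ⟨θ, hθ, rfl⟩
  obtain ⟨h1, h2⟩ := h.choose_spec
  simp only [dif_pos h]
  have h3 := m.incentiveCompatible θ hθ _ h1
  have h4 := m.incentiveCompatible _ h1 θ hθ
  rw [h2] at h3 h4
  linarith

/-- The types in `S` with net quantity `k`. -/
def part (S : Set ℝ) (k : ℝ) : Set ℝ := S ∩ {θ | θ ∈ Icc (0 : ℝ) 1 ∧ m.q θ = k}

/-- Measurability of `q` is not part of a mechanism; it comes from monotonicity, which makes the
level sets order-connected. -/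
lemma measurableSet_part {S : Set ℝ} (hS : MeasurableSet S) (k : ℝ) :
    MeasurableSet (m.part S k) := by
  refine hS.inter (OrdConnected.measurableSet ⟨fun x hx y hy z hz => ?_⟩)
  have hz' : z ∈ Icc (0 : ℝ) 1 := ⟨hx.1.1.trans hz.1, hz.2.trans hy.1.2⟩
  exact ⟨hz', le_antisymm (hy.2 ▸ m.monotoneOn_q hz' hy.1 hz.2)
    (hx.2 ▸ m.monotoneOn_q hx.1 hz' hz.1)⟩

lemma part_union {S : Set ℝ} (hS : S ⊆ Icc 0 1) :
    m.part S (-1) ∪ m.part S 0 ∪ m.part S 1 = S := by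
  refine Subset.antisymm (union_subset (union_subset inter_subset_left inter_subset_left)
    inter_subset_left) fun x hx => ?_
  rcases m.deterministic x (hS hx) with h | h | h
  · exact Or.inl (Or.inl ⟨hx, hS hx, h⟩)
  · exact Or.inl (Or.inr ⟨hx, hS hx, h⟩)
  · exact Or.inr ⟨hx, hS hx, h⟩

lemma disjoint_part (S : Set ℝ) {k l : ℝ} (h : k ≠ l) : Disjoint (m.part S k) (m.part S l) := by
  rw [Set.disjoint_left]
  intro x hx hx'
  exact h (hx.2.2.symm.trans hx'.2.2)

lemma setIntegral_comp_q (μ : Measure ℝ) [IsFiniteMeasure μ] {S : Set ℝ} (hS : S ⊆ Icc 0 1)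
    (hSm : MeasurableSet S) (φ : ℝ → ℝ) :
    ∫ θ in S, φ (m.q θ) ∂μ = φ (-1) * μ.real (m.part S (-1)) + φ 0 * μ.real (m.part S 0) +
      φ 1 * μ.real (m.part S 1) := by
  have hc : ∀ k, EqOn (fun θ => φ (m.q θ)) (fun _ => φ k) (m.part S k) := fun k θ hθ => by
    simp only [hθ.2.2]
  have hi : ∀ k, IntegrableOn (fun θ => φ (m.q θ)) (m.part S k) μ := fun k =>
    (integrableOn_congr_fun (hc k) (m.measurableSet_part hSm k)).2 (integrable_const _)
  have hv : ∀ k, ∫ θ in m.part S k, φ (m.q θ) ∂μ = φ k * μ.real (m.part S k) := fun k => by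
    rw [setIntegral_congr_fun (m.measurableSet_part hSm k) (hc k), setIntegral_const, smul_eq_mul,
      mul_comm]
  have h1 : Disjoint (m.part S (-1) ∪ m.part S 0) (m.part S 1) :=
    disjoint_union_left.2 ⟨m.disjoint_part S (by norm_num), m.disjoint_part S (by norm_num)⟩
  have h2 : Disjoint (m.part S (-1)) (m.part S 0) := m.disjoint_part S (by norm_num)
  calc ∫ θ in S, φ (m.q θ) ∂μ
      = ∫ θ in m.part S (-1) ∪ m.part S 0 ∪ m.part S 1, φ (m.q θ) ∂μ := by rw [m.part_union hS]
    _ = _ := by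
      rw [setIntegral_union h1 (m.measurableSet_part hSm 1) ((hi _).union (hi _)) (hi _),
        setIntegral_union h2 (m.measurableSet_part hSm 0) (hi _) (hi _), hv, hv, hv]

end DirectMechanism

/-! ### Subgame equilibria -/

section Payoff

variable {A : Announcement f} {s : Segmentation} {θ θ' : ℝ}

lemma payoff_of_mem_market (hS : law f s.market ≠ 0) (hθ : θ ∈ s.market) :
    payoff f p A s θ = (A.terms s.market).utility θ := by
  rw [payoff, if_pos hθ, marketPayoff, if_neg hS]

lemma payoff_of_mem_search (hθ : θ ∈ s.search) :
    payoff f p A s θ = searchPayoff f p s.search θ := by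
  rw [payoff, if_neg fun h => s.disjoint.notMem_of_mem_left h hθ, if_pos hθ]

lemma payoff_of_notMem (h : θ ∉ s.market) (h' : θ ∉ s.search) : payoff f p A s θ = 0 := by
  rw [payoff, if_neg h, if_neg h']

namespace IsSubgameEquilibrium

lemma mem_market_or_search (hf : IsValuationDensity f) (hp : 0 < p)
    (h : IsSubgameEquilibrium f p A s) (hD : law f s.search ≠ 0) (hθ : θ ∈ Icc (0 : ℝ) 1) :
    θ ∈ s.market ∨ θ ∈ s.search := by
  by_contra! hn
  have := h.search_le θ hθ
  rw [payoff_of_notMem hn.1 hn.2] at this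
  exact this.not_gt (searchPayoff_pos hf hp hD θ)

/-- If nobody searches, then two types who could search together do not both prefer that. -/
lemma le_payoff_or (h : IsSubgameEquilibrium f p A s) (hD : law f s.search = 0)
    (hθ : θ ∈ Icc (0 : ℝ) 1) (hθ' : θ' ∈ Icc (0 : ℝ) 1) (hne : θ ≠ θ') (hs : θ ∉ s.search)
    (hs' : θ' ∉ s.search) :
    p / 2 * |θ' - θ| ≤ payoff f p A s θ ∨ p / 2 * |θ' - θ| ≤ payoff f p A s θ' := by
  by_contra! hn
  refine h.no_pair_to_search ⟨θ, hθ, θ', hθ', hne, hs, hs', ?_, ?_⟩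
  · rw [pairSearchPayoff, if_pos hD]
    linarith [hn.1]
  · rw [pairSearchPayoff, if_pos hD, abs_sub_comm]
    linarith [hn.2]

/-- Two participants in the marketplace get at least what they would get by searching together. -/
lemma le_payoff_add (hf : IsValuationDensity f) (hp : 0 < p) (h : IsSubgameEquilibrium f p A s)
    (hθ : θ ∈ s.market) (hθ' : θ' ∈ s.market) :
    p / 2 * (θ' - θ) ≤ payoff f p A s θ + payoff f p A s θ' := by
  have hI := s.market_subset hθ
  have hI' := s.market_subset hθ'
  have h0 := h.neither_le θ hI
  have h0' := h.neither_le θ' hI'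
  -- When nobody searches, stability protects only one of the two agents, but that one then gets the
  -- whole `p / 2 * |θ' - θ|`, and the other's payoff is nonnegative.
  by_cases hD : law f s.search = 0
  · rcases eq_or_ne θ θ' with rfl | hne
    · rw [sub_self, mul_zero]
      linarith
    · have h1 : p / 2 * (θ' - θ) ≤ p / 2 * |θ' - θ| :=
        mul_le_mul_of_nonneg_left (le_abs_self _) (by linarith)
      rcases h.le_payoff_or hD hI hI' hne (s.disjoint.notMem_of_mem_left hθ)
        (s.disjoint.notMem_of_mem_left hθ') with h2 | h2 <;> linarith
  · linarith [le_searchPayoff_add hf hp hD θ θ', h.search_le θ hI, h.search_le θ' hI']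

end IsSubgameEquilibrium

end Payoff

/-! ### The bound on profits -/

/-- In a marketplace with positive profit, sellers get `σ`, buyers pay `β`, and the others get `κ`;
`c` is the highest selling type and `d` the lowest buying type. -/
structure TradeData (f : ℝ → ℝ) (p : ℝ) (A : Announcement f) (s : Segmentation)
    (β σ κ c d : ℝ) : Prop where
  t_sell : ∀ θ ∈ Icc (0 : ℝ) 1, (A.terms s.market).q θ = -1 → (A.terms s.market).t θ = -σ
  t_zero : ∀ θ ∈ Icc (0 : ℝ) 1, (A.terms s.market).q θ = 0 → (A.terms s.market).t θ = -κ
  t_buy : ∀ θ ∈ Icc (0 : ℝ) 1, (A.terms s.market).q θ = 1 → (A.terms s.market).t θ = β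
  left_mem : c ∈ Icc (0 : ℝ) 1
  right_mem : d ∈ Icc (0 : ℝ) 1
  le : c ≤ d
  left_mem_closure : c ∈ closure ((A.terms s.market).part s.market (-1))
  right_mem_closure : d ∈ closure ((A.terms s.market).part s.market 1)
  sell_subset : (A.terms s.market).part s.market (-1) ⊆ Icc 0 c
  buy_subset : (A.terms s.market).part s.market 1 ⊆ Icc d 1
  spread_le : β - σ ≤ (1 - p / 2) * (d - c)
  subsidy_nonneg : 0 ≤ κ * (law f).real ((A.terms s.market).part s.market 0)
  sell_pos : 0 ≤ σ
  buy_le_sell : (law f).real ((A.terms s.market).part s.market 1) ≤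
    (law f).real ((A.terms s.market).part s.market (-1))
  profit_eq : profit f A s = β * (law f).real ((A.terms s.market).part s.market 1) -
    σ * (law f).real ((A.terms s.market).part s.market (-1)) -
    κ * (law f).real ((A.terms s.market).part s.market 0)

lemma law_market_ne_zero {A : Announcement f} {s : Segmentation} (h : 0 < profit f A s) :
    law f s.market ≠ 0 := by
  intro h0
  rw [profit, setIntegral_measure_zero _ h0] at h
  exact h.false

/-- By incentive compatibility each quantity has a single price. Participation means that sellers
and nontraders pay nothing on balance, so positive profit requires buyers, and feasibility then
requires sellers. -/
lemma IsSubgameEquilibrium.exists_tradeData (hf : IsValuationDensity f) (hp0 : 0 < p)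
    {A : Announcement f} {s : Segmentation} (h : IsSubgameEquilibrium f p A s)
    (hpos : 0 < profit f A s) : ∃ β σ κ c d, TradeData f p A s β σ κ c d := by
  have := hf.isProbabilityMeasure
  have hS := law_market_ne_zero hpos
  set m := A.terms s.market with hm
  obtain ⟨τ, hτ⟩ := m.exists_price
  have hpay : ∀ {θ k}, θ ∈ m.part s.market k → 0 ≤ payoff f p A s θ ∧
      payoff f p A s θ = k * θ - τ k := by
    intro θ k hθ
    refine ⟨h.neither_le θ hθ.2.1, ?_⟩
    rw [payoff_of_mem_market hS hθ.1, ← hm, DirectMechanism.utility, hτ θ hθ.2.1, hθ.2.2, mul_comm]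
  have hprofit : profit f A s = τ (-1) * (law f).real (m.part s.market (-1)) +
      τ 0 * (law f).real (m.part s.market 0) + τ 1 * (law f).real (m.part s.market 1) := by
    rw [← m.setIntegral_comp_q (law f) s.market_subset s.measurableSet_market, profit]
    exact setIntegral_congr_fun s.measurableSet_market fun θ hθ => hτ θ (s.market_subset hθ)
  have hfeas := A.feasible s.market s.market_subset s.measurableSet_market
  rw [← hm, m.setIntegral_comp_q (law f) s.market_subset s.measurableSet_market (fun k => k)]
    at hfeas
  have hzero : 0 ≤ -τ 0 * (law f).real (m.part s.market 0) := by
    rcases (m.part s.market 0).eq_empty_or_nonempty with he | ⟨θ, hθ⟩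
    · simp [he]
    · refine mul_nonneg ?_ measureReal_nonneg
      linarith [hpay hθ]
  have hsell : ∀ θ ∈ m.part s.market (-1), 0 ≤ -τ (-1) := fun θ hθ => by
    linarith [hpay hθ, hθ.2.1.1]
  have hneb : (m.part s.market 1).Nonempty := by
    by_contra! he
    rw [hprofit, he, measureReal_empty] at hpos
    rcases (m.part s.market (-1)).eq_empty_or_nonempty with he' | ⟨θ, hθ⟩
    · rw [he', measureReal_empty] at hpos
      linarith
    · have := mul_nonneg (hsell θ hθ) (measureReal_nonneg (μ := law f) (s := m.part s.market (-1)))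
      linarith
  have hnes : (m.part s.market (-1)).Nonempty := by
    by_contra! he
    rw [he, measureReal_empty] at hfeas
    have h0 : (law f).real (m.part s.market 1) = 0 :=
      le_antisymm (by linarith) measureReal_nonneg
    rw [hprofit, he, measureReal_empty, h0] at hpos
    linarith
  have hord : ∀ θ ∈ m.part s.market (-1), ∀ θ' ∈ m.part s.market 1, θ ≤ θ' := by
    intro θ hθ θ' hθ'
    by_contra! hlt
    have := m.monotoneOn_q hθ'.2.1 hθ.2.1 hlt.le
    rw [hθ.2.2, hθ'.2.2] at this
    norm_num at this
  have hspread : ∀ θ ∈ m.part s.market (-1), ∀ θ' ∈ m.part s.market 1,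
      τ 1 + τ (-1) ≤ (1 - p / 2) * (θ' - θ) := by
    intro θ hθ θ' hθ'
    have := h.le_payoff_add hf hp0 hθ.1 hθ'.1
    linarith [hpay hθ, hpay hθ']
  have hbs : BddAbove (m.part s.market (-1)) := ⟨1, fun θ hθ => hθ.2.1.2⟩
  have hbb : BddBelow (m.part s.market 1) := ⟨0, fun θ hθ => hθ.2.1.1⟩
  have hc := csSup_mem_closure hnes hbs
  have hd := csInf_mem_closure hneb hbb
  have hcl : ∀ {k}, closure (m.part s.market k) ⊆ Icc 0 1 := fun {k} =>
    closure_minimal (fun θ hθ => hθ.2.1) isClosed_Icc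
  refine ⟨τ 1, -τ (-1), -τ 0, sSup (m.part s.market (-1)), sInf (m.part s.market 1),
    ?_, ?_, ?_, hcl hc, hcl hd, ?_, hc, hd, ?_, ?_, ?_, hzero, hsell _ hnes.some_mem, ?_, ?_⟩
  · intro θ hθ hq
    rw [← hm] at hq ⊢
    rw [hτ θ hθ, hq, neg_neg]
  · intro θ hθ hq
    rw [← hm] at hq ⊢
    rw [hτ θ hθ, hq, neg_neg]
  · intro θ hθ hq
    rw [← hm] at hq ⊢
    rw [hτ θ hθ, hq]
  · exact csSup_le hnes fun θ hθ => le_csInf hneb fun θ' hθ' => hord θ hθ θ' hθ'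
  · exact fun θ hθ => ⟨hθ.2.1.1, le_csSup hbs hθ⟩
  · exact fun θ hθ => ⟨csInf_le hbb hθ, hθ.2.1.2⟩
  -- The extreme types `c` and `d` need not join themselves, so the pairwise bound is carried to the
  -- closures, in one variable at a time.
  · have h1 : closure (m.part s.market (-1)) ⊆
        {θ | ∀ θ' ∈ m.part s.market 1, τ 1 + τ (-1) ≤ (1 - p / 2) * (θ' - θ)} := by
      refine closure_minimal hspread ?_
      simp only [ofPred_forall]
      exact isClosed_iInter fun θ' => isClosed_iInter fun _ =>
        isClosed_le continuous_const (by fun_prop)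
    have h2 : closure (m.part s.market 1) ⊆
        {θ' | τ 1 + τ (-1) ≤ (1 - p / 2) * (θ' - sSup (m.part s.market (-1)))} :=
      closure_minimal (h1 hc) (isClosed_le continuous_const (by fun_prop))
    have h3 := h2 hd
    rw [mem_ofPred_eq] at h3
    linarith
  · linarith
  · rw [hprofit]
    ring

namespace TradeData

variable {A : Announcement f} {s : Segmentation} {β σ κ c d a b : ℝ}

/-- Profits are at most `1 - p / 2` times the maximal product of volume and spread, and only
optimal cutoffs at which all types beyond the cutoffs trade achieve this. -/
lemma profit_le (hf : IsValuationDensity f) (hp1 : p ≤ 1) (h : TradeData f p A s β σ κ c d)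
    (hab : IsOptimalPair f a b) :
    profit f A s ≤ (1 - p / 2) * (cdf f a * (b - a)) ∧
      ((1 - p / 2) * (cdf f a * (b - a)) ≤ profit f A s → IsOptimalPair f c d ∧
        (law f).real ((A.terms s.market).part s.market (-1)) = cdf f c ∧
        (law f).real ((A.terms s.market).part s.market 1) = 1 - cdf f d ∧
        κ * (law f).real ((A.terms s.market).part s.market 0) = 0 ∧
        β - σ = (1 - p / 2) * (d - c)) := by
  have := hf.isProbabilityMeasure
  have hk : 0 < 1 - p / 2 := by linarith
  have hx : (law f).real ((A.terms s.market).part s.market (-1)) ≤ cdf f c := by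
    rw [← hf.law_real_Icc_zero h.left_mem.1]
    exact measureReal_mono h.sell_subset
  have hy : (law f).real ((A.terms s.market).part s.market 1) ≤ 1 - cdf f d := by
    rw [← hf.law_real_Icc_one h.right_mem.2]
    exact measureReal_mono h.buy_subset
  have hy0 : 0 ≤ (law f).real ((A.terms s.market).part s.market 1) := measureReal_nonneg
  have hz := h.subsidy_nonneg
  have hyx := h.buy_le_sell
  have hsp := h.spread_le
  rw [h.profit_eq]
  generalize (law f).real ((A.terms s.market).part s.market (-1)) = x at *
  generalize (law f).real ((A.terms s.market).part s.market 1) = y at *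
  generalize κ * (law f).real ((A.terms s.market).part s.market 0) = z at *
  obtain ⟨h1, h2⟩ := hab.le_value hf h.left_mem h.right_mem hy0 (hyx.trans hx) hy
  have h3 := mul_le_mul_of_nonneg_left h1 hk.le
  -- Units bought but not resold only cost money, so profit is at most `(β - σ) * y`.
  have h4 := mul_le_mul_of_nonneg_left hyx h.sell_pos
  have h5 := mul_le_mul_of_nonneg_right hsp hy0
  refine ⟨by linarith, fun hle => ?_⟩
  obtain ⟨h6, h7, h8⟩ := h2 (le_of_mul_le_mul_left (by linarith) hk)
  have hypos : 0 < y := by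
    refine hy0.lt_of_ne' fun h0 => ?_
    have := h6.value_pos hf
    rw [← h7, h0, zero_mul] at this
    exact this.false
  refine ⟨h6, by linarith, h8, by linarith, le_antisymm hsp ?_⟩
  exact le_of_mul_le_mul_right (by linarith) hypos

end TradeData

namespace IsSubgameEquilibrium

variable {A : Announcement f} {s : Segmentation} {a b : ℝ}

lemma profit_le (hf : IsValuationDensity f) (hp0 : 0 < p) (hp1 : p ≤ 1)
    (h : IsSubgameEquilibrium f p A s) (hab : IsOptimalPair f a b) :
    profit f A s ≤ (1 - p / 2) * (cdf f a * (b - a)) := by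
  have h0 : 0 ≤ (1 - p / 2) * (cdf f a * (b - a)) :=
    mul_nonneg (by linarith) (hab.value_pos hf).le
  rcases le_or_gt (profit f A s) 0 with hle | hpos
  · exact hle.trans h0
  · obtain ⟨β, σ, κ, c, d, ht⟩ := h.exists_tradeData hf hp0 hpos
    exact (ht.profit_le hf hp1 hab).1

/-- If only a null set of types in a nondegenerate interval search, then the types in that interval
cannot almost all get nothing. -/
lemma not_ae_payoff_eq_zero (hf : IsValuationDensity f) (hp : 0 < p)
    (h : IsSubgameEquilibrium f p A s) (hD : law f s.search = 0) {c d : ℝ} (hc : 0 ≤ c)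
    (hcd : c < d) (hd : d ≤ 1) :
    ¬ ∀ᵐ θ ∂(law f), θ ∈ Ioo c d → payoff f p A s θ = 0 := by
  intro hae
  have := hf.nullSingletonClass
  have hI : law f (Ioo c d) ≠ 0 := (hf.law_Ioo_pos hc hcd hd).ne'
  have hn : ∀ᵐ θ ∂(law f), θ ∉ s.search := measure_eq_zero_iff_ae_notMem.1 hD
  -- Singletons are null, so two distinct types with payoff zero exist; searching together would
  -- benefit both.
  have hE : ¬ (Ioo c d ∩ {θ | payoff f p A s θ = 0 ∧ θ ∉ s.search}).Subsingleton := by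
    intro hsub
    refine hI (measure_mono_null_ae ?_ (hsub.measure_zero (law f)))
    filter_upwards [hae, hn] with θ h1 h2 h3
    exact ⟨h3, h1 h3, h2⟩
  rw [not_subsingleton_iff] at hE
  obtain ⟨x, hx, y, hy, hxy⟩ := hE
  have hI' : Ioo c d ⊆ Icc 0 1 := fun z hz => ⟨hc.trans hz.1.le, hz.2.le.trans hd⟩
  have hpos : 0 < p / 2 * |y - x| :=
    mul_pos (by linarith) (abs_pos.2 (sub_ne_zero.2 hxy.symm))
  have := h.le_payoff_or hD (hI' hx.1) (hI' hy.1) hxy hx.2.2 hy.2.2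
  rw [hx.2.1, hy.2.1, or_self] at this
  linarith

/-- Segmentation and terms of trade are pinned down when the maximal profit is attained. -/
theorem exists_of_le_profit (hf : IsValuationDensity f) (hp0 : 0 < p) (hp1 : p ≤ 1)
    (h : IsSubgameEquilibrium f p A s) (hab : IsOptimalPair f a b)
    (hle : (1 - p / 2) * (cdf f a * (b - a)) ≤ profit f A s) :
    ∃ c d, IsOptimalPair f c d ∧ IsAESimple f s c d ∧ ∀ᵐ θ ∂(law f), θ ∈ s.market →
      (θ ∈ Icc 0 c → (A.terms s.market).q θ = -1 ∧
        (A.terms s.market).t θ = -(c + searchPayoff f p (Ioo c d) c)) ∧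
      (θ ∈ Icc d 1 → (A.terms s.market).q θ = 1 ∧
        (A.terms s.market).t θ = d - searchPayoff f p (Ioo c d) d) := by
  have := hf.isProbabilityMeasure
  have hk : 0 < 1 - p / 2 := by linarith
  have hpos : 0 < profit f A s := (mul_pos hk (hab.value_pos hf)).trans_le hle
  have hS := law_market_ne_zero hpos
  obtain ⟨β, σ, κ, c, d, ht⟩ := h.exists_tradeData hf hp0 hpos
  obtain ⟨hcd, hx, hy, hz, hspread⟩ := (ht.profit_le hf hp1 hab).2 hle
  set m := A.terms s.market with hm
  have hlt := hcd.lt hf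
  -- The sellers lie in `[0,c]` and, by equality in the bound, have its full mass.
  have hsell : m.part s.market (-1) =ᵐ[law f] Icc 0 c := by
    refine ae_eq_of_subset_of_measure_ge ht.sell_subset ?_
      (m.measurableSet_part s.measurableSet_market _).nullMeasurableSet (measure_ne_top _ _)
    rw [← ENNReal.toReal_le_toReal (measure_ne_top _ _) (measure_ne_top _ _),
      ← measureReal_def, ← measureReal_def, hf.law_real_Icc_zero ht.left_mem.1, hx]
  have hbuy : m.part s.market 1 =ᵐ[law f] Icc d 1 := by
    refine ae_eq_of_subset_of_measure_ge ht.buy_subset ?_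
      (m.measurableSet_part s.measurableSet_market _).nullMeasurableSet (measure_ne_top _ _)
    rw [← ENNReal.toReal_le_toReal (measure_ne_top _ _) (measure_ne_top _ _),
      ← measureReal_def, ← measureReal_def, hf.law_real_Icc_one ht.right_mem.2, hy]
  have hmid : ∀ θ ∈ Ioo c d, θ ∈ s.market → θ ∈ m.part s.market 0 := by
    intro θ hθ hθS
    have hI := s.market_subset hθS
    rcases m.deterministic θ hI with hq | hq | hq
    · exact absurd (ht.sell_subset ⟨hθS, hI, hq⟩).2 hθ.1.not_ge
    · exact ⟨hθS, hI, hq⟩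
    · exact absurd (ht.buy_subset ⟨hθS, hI, hq⟩).1 hθ.2.not_ge
  have hpay0 : ∀ θ ∈ m.part s.market 0, payoff f p A s θ = κ := by
    intro θ hθ
    rw [payoff_of_mem_market hS hθ.1, ← hm, DirectMechanism.utility, ht.t_zero θ hθ.2.1 hθ.2.2,
      hθ.2.2]
    ring
  have hzero : κ = 0 ∨ law f (m.part s.market 0) = 0 := by
    rcases mul_eq_zero.1 hz with h0 | h0
    · exact Or.inl h0
    · exact Or.inr ((measureReal_eq_zero_iff (measure_ne_top _ _)).1 h0)
  -- Otherwise almost all types in `(c,d)` would get zero: they stay out, or join without trading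
  -- and without a subsidy.
  have hD : law f s.search ≠ 0 := by
    intro hD
    refine h.not_ae_payoff_eq_zero hf hp0 hD hcd.left_mem.1 hlt hcd.right_mem.2 ?_
    have hn : ∀ᵐ θ ∂(law f), θ ∉ s.search := measure_eq_zero_iff_ae_notMem.1 hD
    rcases hzero with h0 | h0
    · filter_upwards [hn] with θ h1 h2
      by_cases hθ : θ ∈ s.market
      · rw [hpay0 θ (hmid θ h2 hθ), h0]
      · exact payoff_of_notMem hθ h1
    · filter_upwards [hn, measure_eq_zero_iff_ae_notMem.1 h0] with θ h1 h2 h3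
      exact payoff_of_notMem (fun hθ => h2 (hmid θ h3 hθ)) h1
  -- With an active search market, a nontrader without a subsidy would rather search.
  have hnull : law f (m.part s.market 0) = 0 := by
    refine hzero.elim (fun h0 => ?_) id
    convert measure_empty (μ := law f)
    refine eq_empty_of_forall_notMem fun θ hθ => ?_
    have h1 := h.search_le θ hθ.2.1
    rw [hpay0 θ hθ, h0] at h1
    exact h1.not_gt (searchPayoff_pos hf hp0 hD θ)
  have hsimple : IsAESimple f s c d := by
    constructor
    · filter_upwards [hsell.mem_iff, hbuy.mem_iff, measure_eq_zero_iff_ae_notMem.1 hnull]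
        with θ h1 h2 h3
      refine propext ⟨fun hθ => ?_, fun hθ => ?_⟩
      · have hθ' := hθ
        change θ ∈ s.market at hθ'
        rw [← m.part_union s.market_subset] at hθ'
        exact hθ'.elim (fun h => h.elim (fun h => Or.inl (h1.1 h)) fun h => absurd h h3)
          fun h => Or.inr (h2.1 h)
      · exact hθ.elim (fun h => (h1.2 h).1) fun h => (h2.2 h).1
    · filter_upwards [hsell.mem_iff, hbuy.mem_iff, measure_eq_zero_iff_ae_notMem.1 hnull]
        with θ h1 h2 h3
      refine propext ⟨fun hθ => ?_, fun hθ => ?_⟩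
      · have hθS : θ ∉ s.market := fun h => s.disjoint.notMem_of_mem_left h hθ
        have hI := s.search_subset hθ
        exact ⟨not_le.1 fun hle => hθS (h1.2 ⟨hI.1, hle⟩).1,
          not_le.1 fun hle => hθS (h2.2 ⟨hle, hI.2⟩).1⟩
      · have hI : θ ∈ Icc (0 : ℝ) 1 :=
          ⟨hcd.left_mem.1.trans hθ.1.le, hθ.2.le.trans hcd.right_mem.2⟩
        exact (h.mem_market_or_search hf hp0 hD hI).resolve_left
          fun hθS => h3 (hmid θ hθ hθS)
  have hcont := continuous_searchPayoff hf hp0 hp1 (Ioo c d)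
  have hsearch := searchPayoff_congr p hsimple.2
  have hσ : c + searchPayoff f p (Ioo c d) c ≤ σ := by
    have h1 : m.part s.market (-1) ⊆ {θ | θ + searchPayoff f p (Ioo c d) θ ≤ σ} := by
      intro θ hθ
      have h2 := h.search_le θ hθ.2.1
      rw [payoff_of_mem_market hS hθ.1, ← hm, DirectMechanism.utility,
        ht.t_sell θ hθ.2.1 hθ.2.2, hθ.2.2, hsearch] at h2
      rw [mem_ofPred_eq]
      linarith
    exact closure_minimal h1 (isClosed_le (by fun_prop) continuous_const) ht.left_mem_closure
  have hβ : β ≤ d - searchPayoff f p (Ioo c d) d := by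
    have h1 : m.part s.market 1 ⊆ {θ | β ≤ θ - searchPayoff f p (Ioo c d) θ} := by
      intro θ hθ
      have h2 := h.search_le θ hθ.2.1
      rw [payoff_of_mem_market hS hθ.1, ← hm, DirectMechanism.utility,
        ht.t_buy θ hθ.2.1 hθ.2.2, hθ.2.2, hsearch] at h2
      rw [mem_ofPred_eq]
      linarith
    exact closure_minimal h1 (isClosed_le continuous_const (by fun_prop)) ht.right_mem_closure
  -- The bounds `hσ` and `hβ` together allow a spread of at most `(1 - p / 2) * (d - c)`. This is
  -- the actual spread, so both bind.
  have hadd := searchPayoff_Ioo_add hf p hcd.left_mem.1 hlt hcd.right_mem.2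
  refine ⟨c, d, hcd, hsimple, ?_⟩
  filter_upwards [hsell.mem_iff, hbuy.mem_iff] with θ h1 h2 _
  refine ⟨fun hθ => ?_, fun hθ => ?_⟩
  · have hθ' := (h1.2 hθ).2
    exact ⟨hθ'.2, by rw [ht.t_sell θ hθ'.1 hθ'.2]; linarith⟩
  · have hθ' := (h2.2 hθ).2
    exact ⟨hθ'.2, by rw [ht.t_buy θ hθ'.1 hθ'.2]; linarith⟩

end IsSubgameEquilibrium

/-! ### An announcement that implements simple coexistence -/

/-- Types may sell at the price `σ` or buy at the price `β`. -/
noncomputable def postedPrices (σ β : ℝ) (h : σ ≤ β) : DirectMechanism where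
  q θ := if θ ≤ σ then -1 else if β ≤ θ then 1 else 0
  t θ := if θ ≤ σ then -σ else if β ≤ θ then β else 0
  deterministic θ _ := by split_ifs <;> simp
  incentiveCompatible θ _ r _ := by split_ifs <;> linarith

/-- No trade. -/
def shutDown : DirectMechanism where
  q _ := 0
  t _ := 0
  deterministic _ _ := Or.inr (Or.inl rfl)
  incentiveCompatible _ _ _ _ := le_rfl

lemma postedPrices_q_of_le {σ β θ : ℝ} (h : σ ≤ β) (hθ : θ ≤ σ) :
    (postedPrices σ β h).q θ = -1 := if_pos hθ

lemma postedPrices_t_of_le {σ β θ : ℝ} (h : σ ≤ β) (hθ : θ ≤ σ) :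
    (postedPrices σ β h).t θ = -σ := if_pos hθ

lemma postedPrices_q_of_ge {σ β θ : ℝ} (h : σ ≤ β) (h' : σ < θ) (hθ : β ≤ θ) :
    (postedPrices σ β h).q θ = 1 := by
  simp [postedPrices, h'.not_ge, hθ]

lemma postedPrices_t_of_ge {σ β θ : ℝ} (h : σ ≤ β) (h' : σ < θ) (hθ : β ≤ θ) :
    (postedPrices σ β h).t θ = β := by
  simp [postedPrices, h'.not_ge, hθ]

lemma postedPrices_utility {σ β : ℝ} (h : σ ≤ β) (θ : ℝ) :
    (postedPrices σ β h).utility θ = max (max (σ - θ) 0) (θ - β) := by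
  unfold DirectMechanism.utility postedPrices
  simp only
  split_ifs with h1 h2
  · rw [max_eq_left (a := σ - θ) (by linarith), max_eq_left (by linarith)]
    ring
  · rw [max_eq_right]
    · ring
    · exact max_le (by linarith) (by linarith)
  · rw [max_eq_right (a := σ - θ) (by linarith), max_eq_left (by linarith)]
    ring

/-- The types outside the cutoffs. -/
def outside (a b : ℝ) : Set ℝ := Icc 0 a ∪ Icc b 1

/-- The price at which the cutoff type `a` is indifferent between selling and searching. -/
noncomputable def sellPrice (f : ℝ → ℝ) (p a b : ℝ) : ℝ := a + searchPayoff f p (Ioo a b) a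

/-- The price at which the cutoff type `b` is indifferent between buying and searching. -/
noncomputable def buyPrice (f : ℝ → ℝ) (p a b : ℝ) : ℝ := b - searchPayoff f p (Ioo a b) b

namespace IsOptimalPair

variable {a b : ℝ}

lemma searchPayoff_add (hf : IsValuationDensity f) (h : IsOptimalPair f a b) (p : ℝ) :
    searchPayoff f p (Ioo a b) a + searchPayoff f p (Ioo a b) b = p / 2 * (b - a) :=
  searchPayoff_Ioo_add hf p h.left_mem.1 (h.lt hf) h.right_mem.2

lemma law_Ioo_ne_zero (hf : IsValuationDensity f) (h : IsOptimalPair f a b) :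
    law f (Ioo a b) ≠ 0 :=
  (hf.law_Ioo_pos h.left_mem.1 (h.lt hf) h.right_mem.2).ne'

lemma left_lt_sellPrice (hf : IsValuationDensity f) (hp : 0 < p) (h : IsOptimalPair f a b) :
    a < sellPrice f p a b := by
  have := searchPayoff_pos hf hp (h.law_Ioo_ne_zero hf) a
  rw [sellPrice]
  linarith

lemma buyPrice_lt_right (hf : IsValuationDensity f) (hp : 0 < p) (h : IsOptimalPair f a b) :
    buyPrice f p a b < b := by
  have := searchPayoff_pos hf hp (h.law_Ioo_ne_zero hf) b
  rw [buyPrice]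
  linarith

lemma sellPrice_lt_buyPrice (hf : IsValuationDensity f) (hp1 : p ≤ 1) (h : IsOptimalPair f a b) :
    sellPrice f p a b < buyPrice f p a b := by
  have h1 := h.searchPayoff_add hf p
  have h2 := mul_pos (show 0 < 1 - p / 2 by linarith) (sub_pos.2 (h.lt hf))
  rw [sellPrice, buyPrice]
  linarith

lemma outside_subset (h : IsOptimalPair f a b) : outside a b ⊆ Icc 0 1 :=
  union_subset (Icc_subset_Icc_right h.left_mem.2) (Icc_subset_Icc_left h.right_mem.1)

lemma law_outside_ne_zero (hf : IsValuationDensity f) (h : IsOptimalPair f a b) :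
    law f (outside a b) ≠ 0 := by
  refine ((hf.law_Ioo_pos le_rfl (h.pos hf) h.left_mem.2).trans_le (measure_mono ?_)).ne'
  exact Ioo_subset_Icc_self.trans subset_union_left

lemma setIntegral_outside (hf : IsValuationDensity f) (h : IsOptimalPair f a b) {g : ℝ → ℝ}
    {x y : ℝ} (hx : ∀ θ ∈ Icc 0 a, g θ = x) (hy : ∀ θ ∈ Icc b 1, g θ = y) :
    ∫ θ in outside a b, g θ ∂(law f) = cdf f a * (x + y) := by
  have := hf.isProbabilityMeasure
  have hdisj : Disjoint (Icc 0 a) (Icc b 1) :=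
    Set.disjoint_left.2 fun z hz hz' => ((h.lt hf).trans_le hz'.1).not_ge hz.2
  have hxi := (integrableOn_congr_fun hx (μ := law f) measurableSet_Icc).2 (integrable_const _)
  have hyi := (integrableOn_congr_fun hy (μ := law f) measurableSet_Icc).2 (integrable_const _)
  rw [outside, setIntegral_union hdisj measurableSet_Icc hxi hyi,
    setIntegral_congr_fun measurableSet_Icc hx, setIntegral_congr_fun measurableSet_Icc hy,
    setIntegral_const, setIntegral_const, hf.law_real_Icc_zero h.left_mem.1,
    hf.law_real_Icc_one h.right_mem.2, smul_eq_mul, smul_eq_mul,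
    show 1 - cdf f b = cdf f a by linarith [h.clearing]]
  ring

variable (p) in
/-- The mechanism that makes the cutoff types `a` and `b` indifferent. -/
noncomputable def mechanism (hf : IsValuationDensity f) (hp1 : p ≤ 1) (h : IsOptimalPair f a b) :
    DirectMechanism :=
  postedPrices (sellPrice f p a b) (buyPrice f p a b) (h.sellPrice_lt_buyPrice hf hp1).le

/-- The sell price exceeds `a` and the buy price is below `b`, so some searching types would also
trade at these prices. Only those who join count for clearing. -/
lemma integral_q (hf : IsValuationDensity f) (hp0 : 0 < p) (hp1 : p ≤ 1)
    (h : IsOptimalPair f a b) :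
    ∫ θ in outside a b, (h.mechanism p hf hp1).q θ ∂(law f) = 0 := by
  have h1 := h.left_lt_sellPrice hf hp0
  have h2 := h.buyPrice_lt_right hf hp0
  have h3 := h.sellPrice_lt_buyPrice hf hp1
  rw [h.setIntegral_outside hf (x := -1) (y := 1)]
  · ring
  · exact fun θ hθ => postedPrices_q_of_le h3.le (hθ.2.trans h1.le)
  · exact fun θ hθ => postedPrices_q_of_ge h3.le (by linarith [hθ.1]) (h2.le.trans hθ.1)

lemma integral_t (hf : IsValuationDensity f) (hp0 : 0 < p) (hp1 : p ≤ 1)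
    (h : IsOptimalPair f a b) :
    ∫ θ in outside a b, (h.mechanism p hf hp1).t θ ∂(law f) =
      (1 - p / 2) * (cdf f a * (b - a)) := by
  have h1 := h.left_lt_sellPrice hf hp0
  have h2 := h.buyPrice_lt_right hf hp0
  have h3 := h.sellPrice_lt_buyPrice hf hp1
  have h4 := h.searchPayoff_add hf p
  rw [h.setIntegral_outside hf (x := -sellPrice f p a b) (y := buyPrice f p a b)]
  · have h5 : -sellPrice f p a b + buyPrice f p a b = (1 - p / 2) * (b - a) := by
      rw [sellPrice, buyPrice]
      linarith
    rw [h5]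
    ring
  · exact fun θ hθ => postedPrices_t_of_le h3.le (hθ.2.trans h1.le)
  · exact fun θ hθ => postedPrices_t_of_ge h3.le (by linarith [hθ.1]) (h2.le.trans hθ.1)

open Classical in
/-- Operate at the cutoff prices if the types outside the cutoffs join, shut down if other types
join, and offer to trade at the price `1 / 2` if nobody joins. -/
noncomputable def announcement (hf : IsValuationDensity f) (hp0 : 0 < p) (hp1 : p ≤ 1)
    (h : IsOptimalPair f a b) : Announcement f where
  terms S :=
    -- Trade at price `1 / 2` is offered at null sets to break the outcome in which everybody
    -- searches; feasibility is trivial there.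
    if S =ᵐ[law f] outside a b then h.mechanism p hf hp1
    else if law f S = 0 then postedPrices (1 / 2) (1 / 2) le_rfl
    else shutDown
  feasible S _ _ := by
    split_ifs with h1 h2
    · rw [setIntegral_congr_set h1, h.integral_q hf hp0 hp1]
    · rw [setIntegral_measure_zero _ h2]
    · simp [shutDown]

variable (hf : IsValuationDensity f) (hp0 : 0 < p) (hp1 : p ≤ 1) (h : IsOptimalPair f a b)

lemma announcement_terms_of_ae_eq {S : Set ℝ} (hS : S =ᵐ[law f] outside a b) :
    (h.announcement hf hp0 hp1).terms S = h.mechanism p hf hp1 := if_pos hS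

lemma announcement_terms_of_null {S : Set ℝ} (hS : law f S = 0) :
    (h.announcement hf hp0 hp1).terms S = postedPrices (1 / 2) (1 / 2) le_rfl := by
  have h1 : ¬ S =ᵐ[law f] outside a b := fun hS' =>
    h.law_outside_ne_zero hf (by rw [← measure_congr hS', hS])
  simp only [announcement, if_neg h1, if_pos hS]

lemma announcement_terms_of_ne {S : Set ℝ} (hS : law f S ≠ 0)
    (hS' : ¬ S =ᵐ[law f] outside a b) :
    (h.announcement hf hp0 hp1).terms S = shutDown := by
  simp only [announcement, if_neg hS', if_neg hS]

/-- In every equilibrium of the subgame, the marketplace operates at the cutoff prices. -/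
lemma market_ae_eq_outside {s : Segmentation}
    (hs : IsSubgameEquilibrium f p (h.announcement hf hp0 hp1) s) :
    s.market =ᵐ[law f] outside a b := by
  by_contra hne
  -- Joining a null or a shut down marketplace yields zero. If the search market is also null, a
  -- pair moves to search; if it is active, the marketplace is empty and everybody searches.
  have hle : ∀ θ ∈ s.market, payoff f p (h.announcement hf hp0 hp1) s θ = 0 := by
    intro θ hθ
    rw [payoff, if_pos hθ, marketPayoff]
    split_ifs with h0
    · rfl
    · rw [h.announcement_terms_of_ne hf hp0 hp1 h0 hne]
      simp [DirectMechanism.utility, shutDown]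
  by_cases hD : law f s.search = 0
  · refine hs.not_ae_payoff_eq_zero hf hp0 hD le_rfl zero_lt_one le_rfl ?_
    filter_upwards [measure_eq_zero_iff_ae_notMem.1 hD] with θ h1 _
    by_cases hθ : θ ∈ s.market
    · exact hle θ hθ
    · exact payoff_of_notMem hθ h1
  have hpos := searchPayoff_pos hf hp0 hD
  have hempty : s.market = ∅ := by
    refine eq_empty_of_forall_notMem fun θ hθ => ?_
    have h1 := hs.search_le θ (s.market_subset hθ)
    rw [hle θ hθ] at h1
    exact h1.not_gt (hpos θ)
  have hnull : law f s.market = 0 := by rw [hempty, measure_empty]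
  have hsearch : ∀ θ ∈ Icc (0 : ℝ) 1, payoff f p (h.announcement hf hp0 hp1) s θ =
      searchPayoff f p s.search θ := by
    intro θ hθ
    refine payoff_of_mem_search ((hs.mem_market_or_search hf hp0 hD hθ).resolve_left ?_)
    simp [hempty]
  have h0 : (0 : ℝ) ∈ Icc (0 : ℝ) 1 := ⟨le_rfl, zero_le_one⟩
  have h1 : (1 : ℝ) ∈ Icc (0 : ℝ) 1 := ⟨zero_le_one, le_rfl⟩
  have hadd : searchPayoff f p s.search 0 + searchPayoff f p s.search 1 = p / 2 := by
    have hfull : s.search =ᵐ[law f] Ioo 0 1 := by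
      filter_upwards [IsValuationDensity.ae_mem_Ioo (f := f)] with θ hθ
      refine propext ⟨fun _ => hθ, fun _ => ?_⟩
      refine (hs.mem_market_or_search hf hp0 hD (Ioo_subset_Icc_self hθ)).resolve_left ?_
      simp [hempty]
    rw [searchPayoff_congr p hfull, searchPayoff_congr p hfull,
      searchPayoff_Ioo_add hf p le_rfl zero_lt_one le_rfl]
    ring
  have hterms := h.announcement_terms_of_null hf hp0 hp1 hnull
  have hq0 : (postedPrices (1 / 2) (1 / 2) le_rfl).q 0 = -1 :=
    postedPrices_q_of_le _ (by norm_num)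
  have hq1 : (postedPrices (1 / 2) (1 / 2) le_rfl).q 1 = 1 :=
    postedPrices_q_of_ge _ (by norm_num) (by norm_num)
  -- Types `0` and `1` trading at `1 / 2` get `1 / 2` each. Their search payoffs are positive and
  -- sum to `p / 2`, so each is strictly below `1 / 2`, even when `p = 1`.
  refine hs.no_pair_to_market ⟨0, h0, 1, h1, zero_ne_one, by simp [hempty], by simp [hempty],
    ?_, ?_⟩
  · rw [hsearch 0 h0, pairMarketPayoff, if_pos hnull, hterms, hq0, hq1, neg_add_cancel,
      if_pos rfl, postedPrices_utility]
    have := hpos 1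
    norm_num
    linarith
  · rw [hsearch 1 h1, pairMarketPayoff, if_pos hnull, hterms, hq0, hq1, add_neg_cancel,
      if_pos rfl, postedPrices_utility]
    have := hpos 0
    norm_num
    linarith

lemma profit_announcement {s : Segmentation} (hs : s.market =ᵐ[law f] outside a b) :
    profit f (h.announcement hf hp0 hp1) s = (1 - p / 2) * (cdf f a * (b - a)) := by
  rw [profit, h.announcement_terms_of_ae_eq hf hp0 hp1 hs, setIntegral_congr_set hs,
    h.integral_t hf hp0 hp1]

/-- The types outside the cutoffs join the marketplace, the others search. -/
def segmentation (h : IsOptimalPair f a b) : Segmentation where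
  market := outside a b
  search := Ioo a b
  market_subset := h.outside_subset
  search_subset _ hθ := ⟨h.left_mem.1.trans hθ.1.le, hθ.2.le.trans h.right_mem.2⟩
  measurableSet_market := measurableSet_Icc.union measurableSet_Icc
  measurableSet_search := measurableSet_Ioo
  disjoint := Set.disjoint_left.2 fun _ hx hx' =>
    hx.elim (fun hx => hx'.1.not_ge hx.2) fun hx => hx'.2.not_ge hx.1

lemma isSubgameEquilibrium_segmentation :
    IsSubgameEquilibrium f p (h.announcement hf hp0 hp1) (h.segmentation) := by
  have hS : law f (h.segmentation).market ≠ 0 := h.law_outside_ne_zero hf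
  have hD : law f (h.segmentation).search ≠ 0 := h.law_Ioo_ne_zero hf
  have hterms : (h.announcement hf hp0 hp1).terms (h.segmentation).market =
      h.mechanism p hf hp1 := h.announcement_terms_of_ae_eq hf hp0 hp1 (ae_eq_refl _)
  have hmarket : ∀ θ, marketPayoff f (h.announcement hf hp0 hp1) (h.segmentation) θ =
      max (max (sellPrice f p a b - θ) 0) (θ - buyPrice f p a b) := by
    intro θ
    rw [marketPayoff, if_neg hS, hterms, mechanism, postedPrices_utility]
  have hab := h.lt hf
  have hlip := searchPayoff_le_add hf hp0 hp1 (Ioo a b)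
  have hpos := searchPayoff_pos hf hp0 (h.law_Ioo_ne_zero hf)
  -- Every type is in its better market, by indifference at the cutoffs and the slope comparison. As
  -- both markets are active, joint moves pay no more than individual ones, so this settles all
  -- equilibrium conditions.
  have hmax : ∀ θ ∈ Icc (0 : ℝ) 1, payoff f p (h.announcement hf hp0 hp1) (h.segmentation) θ =
      max (marketPayoff f (h.announcement hf hp0 hp1) (h.segmentation) θ)
        (searchPayoff f p (Ioo a b) θ) := by
    intro θ hθ
    have h1 := hlip θ a
    have h2 := hlip a θ
    have h3 := hlip θ b
    have h4 := hlip b θ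
    rcases le_or_gt θ a with hθa | hθa
    · have hmem : θ ∈ (h.segmentation).market := Or.inl ⟨hθ.1, hθa⟩
      rw [payoff, if_pos hmem, max_eq_left]
      rw [hmarket]
      refine le_max_of_le_left (le_max_of_le_left ?_)
      rw [abs_of_nonpos (by linarith)] at h1
      rw [sellPrice]
      linarith
    rcases le_or_gt b θ with hθb | hθb
    · have hmem : θ ∈ (h.segmentation).market := Or.inr ⟨hθb, hθ.2⟩
      rw [payoff, if_pos hmem, max_eq_left]
      rw [hmarket]
      refine le_max_of_le_right ?_
      rw [abs_of_nonneg (by linarith)] at h3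
      rw [buyPrice]
      linarith
    · have hmem : θ ∈ (h.segmentation).search := ⟨hθa, hθb⟩
      rw [payoff_of_mem_search hmem, max_eq_right]
      · rfl
      rw [hmarket]
      rw [abs_of_nonpos (by linarith)] at h2
      rw [abs_of_nonneg (by linarith)] at h4
      refine max_le (max_le ?_ (hpos θ).le) ?_
      · rw [sellPrice]
        linarith
      · rw [buyPrice]
        linarith
  refine ⟨fun θ hθ => ?_, fun θ hθ => ?_, fun θ hθ => ?_, ?_, ?_⟩
  · rw [hmax θ hθ]
    exact le_max_of_le_right (hpos θ).le
  · rw [hmax θ hθ]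
    exact le_max_left _ _
  · rw [hmax θ hθ]
    exact le_max_right _ _
  · rintro ⟨θ, hθ, θ', -, -, -, -, hlt, -⟩
    rw [pairSearchPayoff, if_neg hD, hmax θ hθ] at hlt
    exact (le_max_right _ _).not_gt hlt
  · rintro ⟨θ, hθ, θ', -, -, -, -, hlt, -⟩
    rw [pairMarketPayoff, if_neg hS, hmax θ hθ, marketPayoff, if_neg hS] at hlt
    exact (le_max_left _ _).not_gt hlt

end IsOptimalPair

/-! ### Equilibria -/

/-- In every equilibrium the designer attains the maximal profit. -/
lemma IsEquilibrium.le_profit (hf : IsValuationDensity f) (hp0 : 0 < p) (hp1 : p ≤ 1)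
    {e : StrategyProfile f} (he : IsEquilibrium f p e) {a b : ℝ} (h : IsOptimalPair f a b) :
    (1 - p / 2) * (cdf f a * (b - a)) ≤ profit f e.announcement e.outcome := by
  have hadm : (h.announcement hf hp0 hp1).Admissible p :=
    ⟨_, h.isSubgameEquilibrium_segmentation hf hp0 hp1⟩
  -- The prescribed response to this announcement is arbitrary, yet its marketplace, hence the
  -- profit, is determined.
  have hmarket := h.market_ae_eq_outside hf hp0 hp1 (he.subgame _ hadm)
  rw [← h.profit_announcement hf hp0 hp1 hmarket]
  exact he.optimal _ hadm

lemma IsEquilibrium.exists_optimal (hf : IsValuationDensity f) (hp0 : 0 < p) (hp1 : p ≤ 1)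
    {e : StrategyProfile f} (he : IsEquilibrium f p e) :
    ∃ a b, IsOptimalPair f a b ∧ IsAESimple f e.outcome a b ∧
      ∀ᵐ θ ∂(law f), θ ∈ e.outcome.market →
        (θ ∈ Icc 0 a → e.mechanism.q θ = -1 ∧
          e.mechanism.t θ = -(a + searchPayoff f p (Ioo a b) a)) ∧
        (θ ∈ Icc b 1 → e.mechanism.q θ = 1 ∧
          e.mechanism.t θ = b - searchPayoff f p (Ioo a b) b) := by
  obtain ⟨a, b, h⟩ := exists_isOptimalPair hf
  exact (he.subgame _ he.admissible).exists_of_le_profit hf hp0 hp1 h (he.le_profit hf hp0 hp1 h)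

/-- Responses to other admissible announcements may be any subgame equilibria, since the profit
bound holds in all of them. -/
lemma IsOptimalPair.exists_isEquilibrium (hf : IsValuationDensity f) (hp0 : 0 < p) (hp1 : p ≤ 1)
    {a b : ℝ} (h : IsOptimalPair f a b) :
    ∃ e : StrategyProfile f, IsEquilibrium f p e ∧ e.outcome = h.segmentation := by
  classical
  have hsub := h.isSubgameEquilibrium_segmentation hf hp0 hp1
  let e : StrategyProfile f :=
    { announcement := h.announcement hf hp0 hp1
      response := fun A => if A = h.announcement hf hp0 hp1 then h.segmentation
        else if hA : A.Admissible p then hA.choose else h.segmentation }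
  have hout : e.outcome = h.segmentation := if_pos rfl
  have hresp : ∀ A : Announcement f, A.Admissible p →
      IsSubgameEquilibrium f p A (e.response A) := by
    intro A hA
    by_cases hAe : A = h.announcement hf hp0 hp1
    · rw [hAe, show e.response (h.announcement hf hp0 hp1) = h.segmentation from hout]
      exact hsub
    · rw [show e.response A = hA.choose by simp only [e, if_neg hAe, dif_pos hA]]
      exact hA.choose_spec
  refine ⟨e, ⟨⟨_, hsub⟩, hresp, fun A hA => ?_⟩, hout⟩
  rw [hout, show e.announcement = h.announcement hf hp0 hp1 from rfl,
    h.profit_announcement hf hp0 hp1 (ae_eq_refl _)]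
  exact (hresp A hA).profit_le hf hp0 hp1 h

lemma IsCutoffPair.not_isAESimple_of_ae_mem_market (hf : IsValuationDensity f) {s : Segmentation}
    {a b : ℝ} (h : IsCutoffPair f a b) (hs : IsAESimple f s a b) :
    ¬ ∀ᵐ θ ∂(law f), θ ∈ s.market := by
  intro hall
  refine (hf.law_Ioo_pos h.pos.le h.lt h.lt_one.le).ne' ?_
  rw [← measure_congr hs.2, measure_eq_zero_iff_ae_notMem]
  filter_upwards [hall] with θ hθ using s.disjoint.notMem_of_mem_left hθ

lemma IsCutoffPair.not_isAESimple_of_ae_mem_search (hf : IsValuationDensity f) {s : Segmentation}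
    {a b : ℝ} (h : IsCutoffPair f a b) (hs : IsAESimple f s a b) :
    ¬ ∀ᵐ θ ∂(law f), θ ∈ s.search := by
  intro hall
  refine (hf.law_Ioo_pos le_rfl h.pos (h.lt.trans h.lt_one).le).ne'
    (measure_mono_null (Ioo_subset_Icc_self.trans (subset_union_left (t := Icc b 1))) ?_)
  rw [← measure_congr hs.1, measure_eq_zero_iff_ae_notMem]
  filter_upwards [hall] with θ hθ using s.disjoint.notMem_of_mem_right hθ

/-- Both profiles have optimal, hence equal, cutoffs, and the cutoffs determine the prices through
the indifference of the marginal types. -/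
lemma IsEquilibrium.sameOutcome (hf : IsValuationDensity f) (hreg : IsRegular f) (hp0 : 0 < p)
    (hp1 : p ≤ 1)
    (hs : StrictMonoOn (virtualValue f) (Ioo 0 1) ∨ StrictMonoOn (virtualCost f) (Ioo 0 1))
    {e e' : StrategyProfile f} (he : IsEquilibrium f p e) (he' : IsEquilibrium f p e') :
    SameOutcome e e' := by
  obtain ⟨a, b, h, hae, hm⟩ := he.exists_optimal hf hp0 hp1
  obtain ⟨c, d, h', hae', hm'⟩ := he'.exists_optimal hf hp0 hp1
  obtain ⟨rfl, rfl⟩ := IsCutoffPair.unique hf hreg hs (h.isCutoffPair hf) (h'.isCutoffPair hf)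
  refine ⟨hae.1.trans hae'.1.symm, hae.2.trans hae'.2.symm, ?_⟩
  filter_upwards [hm, hm', hae.1.mem_iff, hae'.1.mem_iff] with θ h1 h2 h3 h4 hθ
  have hθo := h3.1 hθ
  have hθ' := h4.2 hθo
  rcases hθo with hθo | hθo
  · obtain ⟨hq, ht⟩ := (h1 hθ).1 hθo
    obtain ⟨hq', ht'⟩ := (h2 hθ').1 hθo
    exact ⟨hq.trans hq'.symm, ht.trans ht'.symm⟩
  · obtain ⟨hq, ht⟩ := (h1 hθ).2 hθo
    obtain ⟨hq', ht'⟩ := (h2 hθ').2 hθo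
    exact ⟨hq.trans hq'.symm, ht.trans ht'.symm⟩

end MarketChoice

theorem mainTheorem1 (f : ℝ → ℝ) (hf : MarketChoice.IsValuationDensity f)
    (hreg : MarketChoice.IsRegular f) (p : ℝ) (hp0 : 0 < p) (hp1 : p ≤ 1) :
    -- no equilibrium in which (almost) all agents join the centralized marketplace
    (¬ ∃ e : MarketChoice.StrategyProfile f, MarketChoice.IsEquilibrium f p e ∧
      ∀ᵐ θ ∂(MarketChoice.law f), θ ∈ e.outcome.market) ∧
    -- no equilibrium in which (almost) all agents join the decentralized market
    (¬ ∃ e : MarketChoice.StrategyProfile f, MarketChoice.IsEquilibrium f p e ∧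
      ∀ᵐ θ ∂(MarketChoice.law f), θ ∈ e.outcome.search) ∧
    -- there is a simple equilibrium
    (∃ (e : MarketChoice.StrategyProfile f) (a b : ℝ), MarketChoice.IsEquilibrium f p e ∧
      MarketChoice.IsCutoffPair f a b ∧
      e.outcome.market = Set.Icc 0 a ∪ Set.Icc b 1 ∧ e.outcome.search = Set.Ioo a b) ∧
    -- every equilibrium is simple
    (∀ e : MarketChoice.StrategyProfile f, MarketChoice.IsEquilibrium f p e →
      ∃ a b : ℝ, MarketChoice.IsCutoffPair f a b ∧ MarketChoice.IsAESimple f e.outcome a b) ∧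
    -- the equilibrium outcome is unique
    (StrictMonoOn (MarketChoice.virtualValue f) (Set.Ioo 0 1) ∨
        StrictMonoOn (MarketChoice.virtualCost f) (Set.Ioo 0 1) →
      ∀ e e' : MarketChoice.StrategyProfile f, MarketChoice.IsEquilibrium f p e →
        MarketChoice.IsEquilibrium f p e' → MarketChoice.SameOutcome e e') := by
  have hsimple : ∀ e : MarketChoice.StrategyProfile f, MarketChoice.IsEquilibrium f p e →
      ∃ a b : ℝ, MarketChoice.IsCutoffPair f a b ∧
        MarketChoice.IsAESimple f e.outcome a b := by
    intro e he
    obtain ⟨a, b, h, hae, -⟩ := he.exists_optimal hf hp0 hp1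
    exact ⟨a, b, h.isCutoffPair hf, hae⟩
  refine ⟨?_, ?_, ?_, hsimple, fun hs e e' he he' => he.sameOutcome hf hreg hp0 hp1 hs he'⟩
  · rintro ⟨e, he, hall⟩
    obtain ⟨a, b, h, hae⟩ := hsimple e he
    exact h.not_isAESimple_of_ae_mem_market hf hae hall
  · rintro ⟨e, he, hall⟩
    obtain ⟨a, b, h, hae⟩ := hsimple e he
    exact h.not_isAESimple_of_ae_mem_search hf hae hall
  · obtain ⟨a, b, h⟩ := MarketChoice.exists_isOptimalPair hf
    obtain ⟨e, he, hout⟩ := h.exists_isEquilibrium hf hp0 hp1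
    exact ⟨e, a, b, he, h.isCutoffPair hf, by rw [hout]; rfl, by rw [hout]; rfl⟩
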